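/- Let $H$ be a complex Hilbert space and let $A$ be a selfadjoint positive definite operator in $H$ with dense domain, i.e. $(Ax,x)\ge a_0\|x\|^2$ on $\mathrm{Dom}(A)$ for some $a_0>0$. Let $H_1=\mathrm{Dom}(A^{1/2})$ with the norm $\|x\|_1=\|A^{1/2}x\|$, let $H_{-1}$ be the completion of $H$ in the norm $\|x\|_{-1}=\|A^{-1/2}x\|$, identified with the antidual of $H_1$ through the extension $(\cdot,\cdot)_{-1,1}$ of the inner product of $H$ to $H_{-1}\times H_1$, and regard $A$ also as a bounded operator from $H_1$ to $H_{-1}$. Let $D\in\mathcal B(H_1,H_{-1})$, with operator norm $\|D\|$, and let $\nu>0$ be such that $$\mathrm{Re}(Dx,x)_{-1,1}\ge 0,\qquad |\mathrm{Im}(Dx,x)_{-1,1}|\le\nu\,\mathrm{Re}(Dx,x)_{-1,1}\qquad(x\in H_1).$$ Put $$\alpha=\inf_{0\ne x\in H_1}\frac{\mathrm{Re}(Dx,x)_{-1,1}}{\|x\|_{-1}^2},\quad \beta=\inf_{0\ne x\in H_1}\frac{\mathrm{Re}(Dx,x)_{-1,1}}{\|x\|^2},\quad \delta=\inf_{0\ne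 x\in H_1}\frac{\mathrm{Re}(Dx,x)_{-1,1}}{\|x\|_1^2},$$ and assume $\delta>0$. In the energy space $\mathcal H=H\times H_1$ consider the operator $$\mathcal T(w_1,w_2)=(-(Dw_1+Aw_2),\,w_1),\qquad \mathrm{Dom}(\mathcal T)=\{(w_1,w_2)\in H_1\times H_1:\ Dw_1+Aw_2\in H\},$$ and the pencil $L(\lambda)=\lambda^2E+\lambda D+A\in\mathcal B(H_1,H_{-1})$, where $E:H_1\hookrightarrow H_{-1}$ is the embedding; $\sigma(L)$ is the set of all $\lambda\in\mathbb C$ for which $L(\lambda)$ has no inverse in $\mathcal B(H_{-1},H_1)$. Then $$\omega=\left(\frac1\beta+\frac1{\sqrt{\alpha\delta}}+\frac{\|D\|^2}{2\delta}+\frac12\sqrt{\frac{4\|D\|^2}{\delta\sqrt{\alpha\delta}}+\frac{\|D\|^4}{\delta^2}}\right)^{-1}>0,$$ the operator $\mathcal T$ is the generator of a $C_0$-semigroup $\exp(t\mathcal T)$ in $\mathcal H$, this semigroup is analytic, and there is a constant $C$ with $\|\exp(t\mathcal T)\|\le C e^{-\omega t}$ for all $t\ge0$. Moreover $\sigma(L)=\sigma(\mathcal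 T)$, and for every $b\ge0$ the minimum $$M_b=\min_{\theta>0,\ \theta\ge b^2}M_{\theta,b},\qquad M_{\theta,b}=\nu+\frac{2}{\delta\,(b+\sqrt{b^2+4\theta})}+\frac{\sqrt\theta-b}{\beta},$$ is attained and $$\sigma(L)=\sigma(\mathcal T)\subset\{\lambda\in\mathbb C:\ \mathrm{Re}\,\lambda\le-\omega,\ |\mathrm{Im}\,\lambda|\le M_b|\mathrm{Re}\,\lambda|+b\}.$$ -/

import Mathlib

open scoped InnerProductSpace Topology

noncomputable section

namespace DampedEquation

section Spaces

variable {H : Type*} [NormedAddCommGroup H] [InnerProductSpace ℂ H] [CompleteSpace H]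

/-- `A` is a (densely defined) selfadjoint operator which is positive definite,
`(A x, x) ≥ c ‖x‖²` for some `c > 0`. (A selfadjoint `LinearPMap` is densely defined, see
`IsSelfAdjoint.dense_domain`.) -/
structure IsPosDefSelfAdjoint (A : H →ₗ.[ℂ] H) : Prop where
  isSelfAdjoint : IsSelfAdjoint A
  posDef : ∃ c : ℝ, 0 < c ∧ ∀ x : A.domain, c * ‖(x : H)‖ ^ 2 ≤ (⟪(x : H), A x⟫_ℂ).re

variable {A : H →ₗ.[ℂ] H}

theorem IsPosDefSelfAdjoint.symm (hA : IsPosDefSelfAdjoint A) (x y : A.domain) :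
    ⟪A x, (y : H)⟫_ℂ = ⟪(x : H), A y⟫_ℂ := by
  have h := LinearPMap.adjoint_isFormalAdjoint hA.isSelfAdjoint.dense_domain
  rw [LinearPMap.isSelfAdjoint_def.mp hA.isSelfAdjoint] at h
  exact h x y

theorem IsPosDefSelfAdjoint.bound (hA : IsPosDefSelfAdjoint A) :
    ∃ c : ℝ, 0 < c ∧ ∀ x : A.domain, c * ‖(x : H)‖ ≤ ‖A x‖ := by
  obtain ⟨c, hc, h⟩ := hA.posDef
  refine ⟨c, hc, fun x => ?_⟩
  rcases eq_or_ne ‖(x : H)‖ 0 with h0 | h0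
  · simp [h0]
  · have hp : 0 < ‖(x : H)‖ := lt_of_le_of_ne (norm_nonneg _) h0.symm
    have h1 := (h x).trans ((Complex.re_le_norm _).trans (norm_inner_le_norm (x : H) (A x)))
    refine le_of_mul_le_mul_left ?_ hp
    nlinarith

/-- A positive definite selfadjoint operator has an everywhere defined bounded inverse. -/
theorem IsPosDefSelfAdjoint.exists_inverse (hA : IsPosDefSelfAdjoint A) :
    ∃ G : H →L[ℂ] H, ∀ y : H, (G y, y) ∈ A.graph := by
  obtain ⟨c, hc, hb⟩ := hA.bound
  have hclosed : IsClosed (LinearMap.range A.toFun : Set H) := by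
    have hg : IsClosed (A.graph : Set (H × H)) := hA.isSelfAdjoint.isClosed
    refine IsSeqClosed.isClosed fun u y hu huy => ?_
    choose x hx using hu
    have hcs : CauchySeq (fun n => (x n : H)) := by
      rw [Metric.cauchySeq_iff']
      intro ε hε
      obtain ⟨N, hN⟩ := Metric.cauchySeq_iff'.mp huy.cauchySeq (c * ε) (mul_pos hc hε)
      refine ⟨N, fun n hn => ?_⟩
      have h1 := hN n hn
      have h2 := hb (x n - x N)
      have h3 : A (x n - x N) = u n - u N := by
        rw [LinearPMap.map_sub]
        exact congrArg₂ _ (hx n) (hx N)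
      rw [h3, ← dist_eq_norm] at h2
      rw [dist_eq_norm]
      exact lt_of_mul_lt_mul_left (lt_of_le_of_lt h2 h1) hc.le
    obtain ⟨z, hz⟩ := cauchySeq_tendsto_of_complete hcs
    have hmem : (z, y) ∈ (A.graph : Set (H × H)) := by
      refine hg.mem_of_tendsto (hz.prodMk_nhds huy) (Filter.Eventually.of_forall fun n => ?_)
      have h4 := A.mem_graph (x n)
      have h5 : A (x n) = u n := hx n
      rw [h5] at h4
      exact h4
    obtain ⟨w, -, hw⟩ := A.mem_graph_iff.mp hmem
    exact ⟨w, hw⟩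
  have htop : LinearMap.range A.toFun = ⊤ := by
    have hcl : (LinearMap.range A.toFun).topologicalClosure = LinearMap.range A.toFun :=
      hclosed.submodule_topologicalClosure_eq
    rw [← hcl, Submodule.topologicalClosure_eq_top_iff, Submodule.eq_bot_iff]
    intro v hv
    have hv' : ∀ x : A.domain, ⟪v, A x⟫_ℂ = 0 := fun x =>
      (Submodule.mem_orthogonal' _ _).mp hv _ ⟨x, rfl⟩
    have hd := hA.isSelfAdjoint.dense_domain
    have hmem : v ∈ (LinearPMap.adjoint A).domain :=
      LinearPMap.mem_adjoint_domain_of_exists v ⟨0, fun x => by rw [hv' x, inner_zero_left]⟩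
    rw [LinearPMap.isSelfAdjoint_def.mp hA.isSelfAdjoint] at hmem
    have h6 : A ⟨v, hmem⟩ = 0 := hd.eq_zero_of_inner_left ℂ fun x hx => by
      rw [hA.symm ⟨v, hmem⟩ ⟨x, hx⟩]
      exact hv' ⟨x, hx⟩
    have h7 := hb ⟨v, hmem⟩
    rw [h6, norm_zero] at h7
    have h8 : ‖v‖ ≤ 0 := nonpos_of_mul_nonpos_right h7 hc
    simpa using h8
  have hinj : Function.Injective A.toFun := by
    rw [← LinearMap.ker_eq_bot, LinearMap.ker_eq_bot']
    intro x hx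
    have h7 := hb x
    have h9 : A x = 0 := hx
    rw [h9, norm_zero] at h7
    have h8 : ‖(x : H)‖ ≤ 0 := nonpos_of_mul_nonpos_right h7 hc
    simpa using h8
  let e := LinearEquiv.ofBijective A.toFun ⟨hinj, LinearMap.range_eq_top.mp htop⟩
  have he : ∀ y, A (e.symm y) = y := fun y => e.apply_symm_apply y
  refine ⟨LinearMap.mkContinuous (A.domain.subtype ∘ₗ e.symm.toLinearMap) c⁻¹ fun y => ?_,
    fun y => ?_⟩
  · have h1 := hb (e.symm y)
    rw [he] at h1
    rw [inv_mul_eq_div, le_div_iff₀ hc, mul_comm]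
    exact h1
  · exact A.mem_graph_iff.mpr ⟨e.symm y, rfl, he y⟩

/-- The bounded operator `A⁻¹`. -/
def invOp (hA : IsPosDefSelfAdjoint A) : H →L[ℂ] H := Classical.choose hA.exists_inverse

theorem invOp_mem_graph (hA : IsPosDefSelfAdjoint A) (y : H) : (invOp hA y, y) ∈ A.graph :=
  Classical.choose_spec hA.exists_inverse y

/-- The bounded operator `A^{-1/2}`: the nonnegative square root of `A⁻¹`. -/
def invSqrt (hA : IsPosDefSelfAdjoint A) : H →L[ℂ] H := CFC.sqrt (invOp hA)

theorem invOp_nonneg (hA : IsPosDefSelfAdjoint A) : 0 ≤ invOp hA := by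
  rw [ContinuousLinearMap.nonneg_iff_isPositive, ContinuousLinearMap.isPositive_iff_complex]
  intro y
  obtain ⟨x, hx, hy⟩ := A.mem_graph_iff.mp (invOp_mem_graph hA y)
  obtain ⟨c, hc, h⟩ := hA.posDef
  simp only at hx hy
  have hpos : 0 ≤ (⟪(x : H), A x⟫_ℂ).re := le_trans (by positivity) (h x)
  have him : (⟪(x : H), A x⟫_ℂ).im = 0 := by
    rw [← Complex.conj_eq_iff_im, inner_conj_symm, hA.symm]
  rw [← hx]
  have hy' : ⟪(x : H), y⟫_ℂ = ⟪(x : H), A x⟫_ℂ := by rw [hy]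
  rw [hy']
  exact ⟨Complex.ext (by simp) (by simpa using him.symm), hpos⟩

theorem invSqrt_mul_self (hA : IsPosDefSelfAdjoint A) (y : H) :
    invSqrt hA (invSqrt hA y) = invOp hA y :=
  congrArg (fun B : H →L[ℂ] H => B y) (CFC.sqrt_mul_sqrt_self (invOp hA) (invOp_nonneg hA))

theorem invOp_injective (hA : IsPosDefSelfAdjoint A) : Function.Injective (invOp hA) := by
  rw [injective_iff_map_eq_zero]
  intro y hy
  have h := invOp_mem_graph hA y
  rw [hy] at h
  exact A.graph_fst_eq_zero_snd h rfl

theorem invSqrt_injective (hA : IsPosDefSelfAdjoint A) : Function.Injective (invSqrt hA) := by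
  rw [injective_iff_map_eq_zero]
  intro y hy
  refine (injective_iff_map_eq_zero (invOp hA)).mp (invOp_injective hA) y ?_
  rw [← invSqrt_mul_self, hy, map_zero]

theorem invSqrt_symm (hA : IsPosDefSelfAdjoint A) (x y : H) :
    ⟪invSqrt hA x, y⟫_ℂ = ⟪x, invSqrt hA y⟫_ℂ := by
  have h : 0 ≤ invSqrt hA := CFC.sqrt_nonneg _
  rw [ContinuousLinearMap.nonneg_iff_isPositive] at h
  exact h.isSymmetric x y

/-- The selfadjoint operator `A^{1/2}`, as the inverse of `A^{-1/2}`, with domain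
`Dom (A^{1/2}) = Ran (A^{-1/2})`. -/
def sqrtOp (hA : IsPosDefSelfAdjoint A) : H →ₗ.[ℂ] H :=
  ((invSqrt hA : H →ₗ[ℂ] H).toPMap ⊤).inverse

theorem sqrtOp_graph_iff (hA : IsPosDefSelfAdjoint A) (x y : H) :
    (x, y) ∈ (sqrtOp hA).graph ↔ invSqrt hA y = x := by
  have hk : LinearMap.ker ((invSqrt hA : H →ₗ[ℂ] H).toPMap ⊤).toFun = ⊥ := by
    rw [LinearMap.ker_eq_bot']
    intro z hz
    exact Subtype.ext ((injective_iff_map_eq_zero _).mp (invSqrt_injective hA) z hz)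
  rw [sqrtOp, LinearPMap.inverse_graph hk]
  simp [LinearPMap.mem_graph_iff]

theorem invSqrt_sqrtOp (hA : IsPosDefSelfAdjoint A) (x : (sqrtOp hA).domain) :
    invSqrt hA (sqrtOp hA x) = x :=
  (sqrtOp_graph_iff hA _ _).mp ((sqrtOp hA).mem_graph x)

theorem sqrtOp_injective (hA : IsPosDefSelfAdjoint A) :
    Function.Injective (sqrtOp hA).toFun := by
  intro x y hxy
  apply Subtype.ext
  rw [← invSqrt_sqrtOp hA x, ← invSqrt_sqrtOp hA y]
  exact congrArg _ hxy

/-- `A^{1/2} A^{1/2} = A`, with equality of domains. -/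
theorem sqrtOp_comp_self (hA : IsPosDefSelfAdjoint A) (x z : H) :
    (x, z) ∈ A.graph ↔ ∃ y, (x, y) ∈ (sqrtOp hA).graph ∧ (y, z) ∈ (sqrtOp hA).graph := by
  simp only [sqrtOp_graph_iff]
  constructor
  · intro h
    refine ⟨invSqrt hA z, ?_, rfl⟩
    rw [invSqrt_mul_self]
    obtain ⟨c, hc, hb⟩ := hA.bound
    obtain ⟨u, hu, hu'⟩ := A.mem_graph_iff.mp h
    obtain ⟨v, hv, hv'⟩ := A.mem_graph_iff.mp (invOp_mem_graph hA z)
    have h1 := hb (v - u)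
    rw [LinearPMap.map_sub, hu', hv', sub_self, norm_zero] at h1
    have h2 : ‖((v - u : A.domain) : H)‖ ≤ 0 := nonpos_of_mul_nonpos_right h1 hc
    rw [norm_le_zero_iff, Submodule.coe_sub, hu, hv, sub_eq_zero] at h2
    exact h2
  · rintro ⟨y, h1, h2⟩
    rw [← h1, ← h2, invSqrt_mul_self]
    exact invOp_mem_graph hA z

/-- The space `H₁ = Dom (A^{1/2})`. -/
def H₁ (hA : IsPosDefSelfAdjoint A) : Type _ := (sqrtOp hA).domain

/-- `H₁` carries the norm `‖x‖₁ = ‖A^{1/2} x‖`. -/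
instance (hA : IsPosDefSelfAdjoint A) : NormedAddCommGroup (H₁ hA) :=
  NormedAddCommGroup.induced (sqrtOp hA).domain H (sqrtOp hA).toFun (sqrtOp_injective hA)

/-- `H₁` carries the inner product `(x, y)₁ = (A^{1/2} x, A^{1/2} y)`. -/
instance (hA : IsPosDefSelfAdjoint A) : InnerProductSpace ℂ (H₁ hA) :=
  InnerProductSpace.induced (sqrtOp hA).toFun

instance (hA : IsPosDefSelfAdjoint A) : Inner ℂ (H₁ hA) := InnerProductSpace.toInner

/-- `A^{1/2}` as a linear map from `H₁` to `H`. -/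
def sqrtMap (hA : IsPosDefSelfAdjoint A) : H₁ hA →ₗ[ℂ] H := (sqrtOp hA).toFun

theorem norm_H₁ (hA : IsPosDefSelfAdjoint A) (x : H₁ hA) : ‖x‖ = ‖sqrtMap hA x‖ := rfl

theorem inner_H₁ (hA : IsPosDefSelfAdjoint A) (x y : H₁ hA) :
    ⟪x, y⟫_ℂ = ⟪sqrtMap hA x, sqrtMap hA y⟫_ℂ := rfl

/-- `A^{1/2}` is a unitary operator from `H₁` onto `H`. -/
def sqrtIso (hA : IsPosDefSelfAdjoint A) : H₁ hA ≃ₗᵢ[ℂ] H :=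
  LinearIsometryEquiv.ofSurjective ⟨sqrtMap hA, fun _ => rfl⟩ fun y => by
    obtain ⟨x, -, hx⟩ := (sqrtOp hA).mem_graph_iff.mp
      ((sqrtOp_graph_iff hA (invSqrt hA y) y).mpr rfl)
    exact ⟨x, hx⟩

instance (hA : IsPosDefSelfAdjoint A) : CompleteSpace (H₁ hA) :=
  (completeSpace_congr (e := (sqrtIso hA).toEquiv) (sqrtIso hA).isometry.isUniformEmbedding).mpr
    inferInstance

/-- The inclusion `H₁ ↪ H`. -/
def incl (hA : IsPosDefSelfAdjoint A) : H₁ hA →L[ℂ] H :=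
  LinearMap.mkContinuous (sqrtOp hA).domain.subtype ‖invSqrt hA‖ fun x => by
    have h := (invSqrt hA).le_opNorm (sqrtMap hA x)
    have h1 : invSqrt hA (sqrtMap hA x) = (sqrtOp hA).domain.subtype x := invSqrt_sqrtOp hA x
    rwa [h1] at h

theorem incl_injective (hA : IsPosDefSelfAdjoint A) : Function.Injective (incl hA) :=
  Subtype.val_injective

theorem incl_eq (hA : IsPosDefSelfAdjoint A) (x : H₁ hA) :
    incl hA x = invSqrt hA (sqrtIso hA x) := (invSqrt_sqrtOp hA x).symm

/-- The space `H₋₁`, realised as the antidual of `H₁` with its operator norm (pivot space `H`).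
For `f : H₋₁` and `y : H₁` the duality form `(f, y)_{-1,1}` is `f y`; it is linear in `f` and
conjugate linear in `y`. By `norm_embNeg` and `denseRange_embNeg` this is the completion of `H`
with respect to the norm `‖A^{-1/2} x‖`. -/
abbrev Hneg (hA : IsPosDefSelfAdjoint A) : Type _ := H₁ hA →L⋆[ℂ] ℂ

/-- The embedding `H ↪ H₋₁`, `x ↦ (x, ·)`. -/
def embNeg (hA : IsPosDefSelfAdjoint A) : H →L[ℂ] Hneg hA :=
  ((innerSL ℂ).comp (incl hA)).flip

theorem embNeg_apply (hA : IsPosDefSelfAdjoint A) (x : H) (y : H₁ hA) :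
    embNeg hA x y = ⟪incl hA y, x⟫_ℂ := rfl

/-- `A` as a bounded operator from `H₁` to `H₋₁`: `(A x, y)_{-1,1} = (x, y)₁`. -/
def extOp (hA : IsPosDefSelfAdjoint A) : H₁ hA →L[ℂ] Hneg hA := innerSLFlip ℂ

theorem extOp_apply (hA : IsPosDefSelfAdjoint A) (x y : H₁ hA) :
    extOp hA x y = ⟪y, x⟫_ℂ := rfl

theorem norm_extOp_apply (hA : IsPosDefSelfAdjoint A) (x : H₁ hA) : ‖extOp hA x‖ = ‖x‖ := by
  refine le_antisymm (ContinuousLinearMap.opNorm_le_bound _ (norm_nonneg _) fun y => ?_) ?_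
  · rw [extOp_apply, mul_comm]
    exact norm_inner_le_norm y x
  · rcases eq_or_ne ‖x‖ 0 with h | h
    · rw [h]
      exact norm_nonneg _
    · have h1 := (extOp hA x).le_opNorm x
      rw [extOp_apply, inner_self_eq_norm_sq_to_K] at h1
      have h2 : ‖((‖x‖ : ℂ)) ^ 2‖ = ‖x‖ * ‖x‖ := by simp [sq]
      exact le_of_mul_le_mul_right (h2.symm.le.trans h1)
        (lt_of_le_of_ne (norm_nonneg _) h.symm)

theorem embNeg_eq (hA : IsPosDefSelfAdjoint A) (x : H) :
    embNeg hA x = extOp hA ((sqrtIso hA).symm (invSqrt hA x)) := by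
  ext y
  rw [embNeg_apply, extOp_apply, incl_eq, invSqrt_symm, ← (sqrtIso hA).inner_map_map y,
    LinearIsometryEquiv.apply_symm_apply]

/-- The norm of `H₋₁` restricted to `H` is `‖x‖₋₁ = ‖A^{-1/2} x‖`. -/
theorem norm_embNeg (hA : IsPosDefSelfAdjoint A) (x : H) : ‖embNeg hA x‖ = ‖invSqrt hA x‖ := by
  rw [embNeg_eq, norm_extOp_apply, LinearIsometryEquiv.norm_map]

theorem embNeg_injective (hA : IsPosDefSelfAdjoint A) : Function.Injective (embNeg hA) := by
  rw [injective_iff_map_eq_zero]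
  intro x hx
  refine (injective_iff_map_eq_zero _).mp (invSqrt_injective hA) x ?_
  rw [← norm_eq_zero, ← norm_embNeg, hx, norm_zero]

theorem extOp_surjective (hA : IsPosDefSelfAdjoint A) : Function.Surjective (extOp hA) := by
  intro f
  let g : H₁ hA →L[ℂ] ℂ := ((starL ℂ : ℂ ≃L⋆[ℂ] ℂ) : ℂ →L⋆[ℂ] ℂ).comp f
  refine ⟨(InnerProductSpace.toDual ℂ (H₁ hA)).symm g, ?_⟩
  ext y
  rw [extOp_apply, ← inner_conj_symm, InnerProductSpace.toDual_symm_apply]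
  exact star_star (f y)

/-- `H` is dense in `H₋₁`. -/
theorem denseRange_embNeg (hA : IsPosDefSelfAdjoint A) : DenseRange (embNeg hA) := by
  have h1 : DenseRange (invSqrt hA) := by
    have h2 : (LinearMap.range (invSqrt hA : H →ₗ[ℂ] H)).topologicalClosure = ⊤ := by
      rw [Submodule.topologicalClosure_eq_top_iff, Submodule.eq_bot_iff]
      intro v hv
      refine (injective_iff_map_eq_zero _).mp (invSqrt_injective hA) v ?_
      have h3 : ⟪v, invSqrt hA (invSqrt hA v)⟫_ℂ = 0 :=
        (Submodule.mem_orthogonal' _ _).mp hv _ ⟨invSqrt hA v, rfl⟩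
      rwa [← invSqrt_symm, inner_self_eq_zero] at h3
    exact (Submodule.dense_iff_topologicalClosure_eq_top).mpr h2
  have h4 : (embNeg hA : H → Hneg hA) =
      (extOp hA ∘ (sqrtIso hA).symm) ∘ invSqrt hA := funext (embNeg_eq hA)
  rw [h4]
  refine DenseRange.comp ?_ h1
    ((extOp hA).continuous.comp (sqrtIso hA).symm.continuous)
  exact ((extOp_surjective hA).comp (sqrtIso hA).symm.surjective).denseRange

/-- The extension of `A` to `H₁` agrees with `A` on `Dom A`. -/
theorem extOp_eq_embNeg (hA : IsPosDefSelfAdjoint A) (x : H₁ hA) (z : H)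
    (h : (incl hA x, z) ∈ A.graph) : extOp hA x = embNeg hA z := by
  obtain ⟨y, h1, h2⟩ := (sqrtOp_comp_self hA _ _).mp h
  rw [sqrtOp_graph_iff] at h1 h2
  rw [incl_eq] at h1
  rw [embNeg_eq, h2, invSqrt_injective hA h1, LinearIsometryEquiv.symm_apply_apply]

end Spaces

section Damping

variable {H : Type*} [NormedAddCommGroup H] [InnerProductSpace ℂ H] [CompleteSpace H]
variable {A : H →ₗ.[ℂ] H} (hA : IsPosDefSelfAdjoint A) (D : H₁ hA →L[ℂ] Hneg hA)

/-- `D` is accretive and sectorial with constant `ν`: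
`Re (D x, x) ≥ 0` and `|Im (D x, x)| ≤ ν Re (D x, x)` for all `x ∈ H₁`. -/
structure IsAccretiveSectorial (ν : ℝ) : Prop where
  accretive : ∀ x : H₁ hA, 0 ≤ (D x x).re
  sectorial : ∀ x : H₁ hA, |(D x x).im| ≤ ν * (D x x).re

/-- `α = inf Re (D x, x) / ‖x‖₋₁²` over `x ∈ H₁`, `x ≠ 0`. -/
def dampAlpha : ℝ :=
  ⨅ x : {x : H₁ hA // x ≠ 0}, (D x.1 x.1).re / ‖embNeg hA (incl hA x.1)‖ ^ 2

/-- `β = inf Re (D x, x) / ‖x‖²` over `x ∈ H₁`, `x ≠ 0`. -/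
def dampBeta : ℝ :=
  ⨅ x : {x : H₁ hA // x ≠ 0}, (D x.1 x.1).re / ‖incl hA x.1‖ ^ 2

/-- `δ = inf Re (D x, x) / ‖x‖₁²` over `x ∈ H₁`, `x ≠ 0`. -/
def dampDelta : ℝ :=
  ⨅ x : {x : H₁ hA // x ≠ 0}, (D x.1 x.1).re / ‖x.1‖ ^ 2

/-- The decay rate `ω` as a function of `α`, `β`, `δ` and `N = ‖D‖`. -/
def decayRate (α β δ N : ℝ) : ℝ :=
  (1 / β + 1 / √(α * δ) + N ^ 2 / (2 * δ) +
    1 / 2 * √(4 * N ^ 2 / (δ * √(α * δ)) + N ^ 4 / δ ^ 2))⁻¹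

/-- The slope `M_{θ,b} = ν + 2 / (δ (b + √(b² + 4θ))) + (√θ - b) / β`. -/
def slope (ν β δ θ b : ℝ) : ℝ :=
  ν + 2 / (δ * (b + √(b ^ 2 + 4 * θ))) + (√θ - b) / β

/-- The operator pencil `L(λ) = λ² E + λ D + A` in `B(H₁, H₋₁)`, with `E : H₁ ↪ H₋₁`. -/
def pencil (z : ℂ) : H₁ hA →L[ℂ] Hneg hA :=
  z ^ 2 • (embNeg hA).comp (incl hA) + z • D + extOp hA

/-- The spectrum of the pencil: the complement of the set of all `λ` for which `L(λ)` has an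
inverse in `B(H₋₁, H₁)`. -/
def pencilSpectrum : Set ℂ :=
  {z : ℂ | ∃ R : Hneg hA →L[ℂ] H₁ hA,
    R.comp (pencil hA D z) = ContinuousLinearMap.id ℂ _ ∧
    (pencil hA D z).comp R = ContinuousLinearMap.id ℂ _}ᶜ

/-- The energy space `H × H₁` with the Hilbert space norm `(‖w₁‖² + ‖w₂‖₁²)^{1/2}`. -/
abbrev Energy : Type _ := WithLp 2 (H × H₁ hA)

/-- `Dom T` is the set of all `(w₁, w₂) ∈ H₁ × H₁` with `D w₁ + A w₂ ∈ H`. -/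
def genDomain : Submodule ℂ (Energy hA) where
  carrier := {w | ∃ v : H₁ hA, incl hA v = w.fst ∧ ∃ h : H, embNeg hA h = D v + extOp hA w.snd}
  zero_mem' := ⟨0, by simp, 0, by simp⟩
  add_mem' := by
    rintro w w' ⟨v, hv, h, hh⟩ ⟨v', hv', h', hh'⟩
    refine ⟨v + v', by simp [hv, hv'], h + h', ?_⟩
    simp only [map_add, hh, hh', WithLp.add_snd]
    abel
  smul_mem' := by
    rintro c w ⟨v, hv, h, hh⟩
    exact ⟨c • v, by simp [hv], c • h, by simp [hh]⟩

/-- `w₁` as an element of `H₁`, for `w ∈ Dom T`. -/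
def genFst (w : genDomain hA D) : H₁ hA := Classical.choose w.2

theorem incl_genFst (w : genDomain hA D) : incl hA (genFst hA D w) = w.1.fst :=
  (Classical.choose_spec w.2).1

/-- `D w₁ + A w₂` as an element of `H`, for `w ∈ Dom T`. -/
def genSum (w : genDomain hA D) : H := Classical.choose (Classical.choose_spec w.2).2

theorem embNeg_genSum (w : genDomain hA D) :
    embNeg hA (genSum hA D w) = D (genFst hA D w) + extOp hA w.1.snd :=
  Classical.choose_spec (Classical.choose_spec w.2).2

theorem genFst_add (w w' : genDomain hA D) :
    genFst hA D (w + w') = genFst hA D w + genFst hA D w' :=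
  incl_injective hA (by rw [map_add, incl_genFst, incl_genFst, incl_genFst]; rfl)

theorem genFst_smul (c : ℂ) (w : genDomain hA D) :
    genFst hA D (c • w) = c • genFst hA D w :=
  incl_injective hA (by rw [map_smul, incl_genFst, incl_genFst]; rfl)

/-- The operator `T (w₁, w₂) = (-(D w₁ + A w₂), w₁)` in the energy space. -/
def generator : Energy hA →ₗ.[ℂ] Energy hA where
  domain := genDomain hA D
  toFun :=
    { toFun := fun w => WithLp.toLp 2 (-genSum hA D w, genFst hA D w)
      map_add' := fun w w' => by
        have h : genSum hA D (w + w') = genSum hA D w + genSum hA D w' := by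
          apply embNeg_injective hA
          rw [map_add, embNeg_genSum, embNeg_genSum, embNeg_genSum, genFst_add, map_add,
            Submodule.coe_add, WithLp.add_snd, map_add]
          abel
        rw [h, genFst_add, neg_add]
        rfl
      map_smul' := fun c w => by
        have h : genSum hA D (c • w) = c • genSum hA D w := by
          apply embNeg_injective hA
          rw [map_smul, embNeg_genSum, embNeg_genSum, genFst_smul, map_smul,
            Submodule.coe_smul, WithLp.smul_snd, map_smul, smul_add]
        rw [h, genFst_smul, ← smul_neg]
        rfl }

end Damping

section Semigroups

variable {X : Type*} [NormedAddCommGroup X] [NormedSpace ℂ X]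

/-- The spectrum of an unbounded operator: the complement of the set of all `λ` for which
`λ - T : Dom T → X` has a bounded, everywhere defined inverse. -/
def opSpectrum (T : X →ₗ.[ℂ] X) : Set ℂ :=
  {z : ℂ | ∃ R : X →L[ℂ] X,
    (∀ x : T.domain, R (z • (x : X) - T x) = x) ∧
    (∀ y : X, ∃ x : T.domain, R y = x ∧ z • (x : X) - T x = y)}ᶜ

/-- `(S t)_{t ≥ 0}` is a `C₀`-semigroup (the values `S t` for `t < 0` play no role). -/
structure IsC0Semigroup (S : ℝ → X →L[ℂ] X) : Prop where
  map_zero : S 0 = ContinuousLinearMap.id ℂ X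
  map_add : ∀ s t : ℝ, 0 ≤ s → 0 ≤ t → S (s + t) = (S s).comp (S t)
  continuousOn : ∀ x : X, ContinuousOn (fun t => S t x) (Set.Ici 0)

/-- `T` is the generator of `S`: `x ∈ Dom T` and `T x = y` iff `(S t x - x) / t → y`
as `t → 0+`. -/
def IsGenerator (T : X →ₗ.[ℂ] X) (S : ℝ → X →L[ℂ] X) : Prop :=
  ∀ x y : X, (x, y) ∈ T.graph ↔
    Filter.Tendsto (fun t : ℝ => ((t⁻¹ : ℝ) : ℂ) • (S t x - x)) (𝓝[>] 0) (𝓝 y)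

/-- The open sector `{z ≠ 0 : |arg z| < φ}`. -/
def sector (φ : ℝ) : Set ℂ := {z : ℂ | z ≠ 0 ∧ |z.arg| < φ}

/-- `(S t)_{t ≥ 0}` is an analytic semigroup: for some angle `φ ∈ (0, π/2]` it extends to a
holomorphic operator family on the sector `|arg z| < φ` that satisfies the semigroup law and is
strongly continuous at `0` in every smaller sector. -/
def IsAnalyticSemigroup (S : ℝ → X →L[ℂ] X) : Prop :=
  ∃ φ : ℝ, 0 < φ ∧ φ ≤ Real.pi / 2 ∧ ∃ F : ℂ → X →L[ℂ] X,
    (∀ t : ℝ, 0 ≤ t → F (t : ℂ) = S t) ∧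
    (∀ z ∈ sector φ, ∀ w ∈ sector φ, F (z + w) = (F z).comp (F w)) ∧
    DifferentiableOn ℂ F (sector φ) ∧
    (∀ φ' : ℝ, 0 < φ' → φ' < φ → ∀ x : X,
      Filter.Tendsto (fun z => F z x) (𝓝[sector φ'] 0) (𝓝 x))

end Semigroups

end DampedEquation

end

/-! Applying the isometry A⁻¹ : H₋₁ → H₁ turns L(z) into the bounded operator z²K + zS + 1 on H₁,
where K = A⁻¹E is selfadjoint and nonnegative and S = A⁻¹D. Here ⟪x, Kx⟫ = ‖x‖² in H, ‖Kx‖₁ = ‖x‖₋₁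
and ⟪x, Sx⟫ = (Dx, x), so α, β, δ, ‖D‖ and ν become bounds on K and S (`pencilBounds`). All of them
survive passage to S*, so a lower bound ‖x‖ ≤ C‖L(z)x‖ proved from them also holds for the adjoint
pencil, and the two together give invertibility (`PencilBounds.isUnit_of_norm_le`).

The lower bounds come from the real and imaginary parts of conj(z)·⟪x, L(z)x⟫. Put R = Re (Dx, x),
and work modulo multiples of ‖x‖‖L(z)x‖. For Re z = -r < 0 the real part gives |z|²R ≤ r(|z|²⟪x, Kx⟫
+ ‖x‖²). Now ⟪x, Kx⟫ ≤ R/β, while x ≈ -z(zKx + Sx) together with ‖x‖² ≤ R/δ yields ‖x‖² ≤ |z|²(y² -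
η)R, where ω = (1/β + y²)⁻¹. Hence r ≤ ω is impossible for a spectral point. The gain η > 0 comes
from an angle between zKx and Sx (`re_inner_le_of_separated`) and excludes the line Re z = -ω
itself. The bound on Im z combines the real part with the imaginary part, which controls |‖x‖²/|z|²
- ⟪x, Kx⟫|.

The equation (z - T)w = y reduces to the pencil by eliminating w₂, so the two spectra agree. The
numerical range of T - 1 lies in a sector around the negative half axis, so Q = (T - 1)⁻¹ is bounded
with numerical range in such a sector. The semigroup of Q⁻¹ is the operator-norm limit of exp(z(Q -
ε)⁻¹) as ε runs through 2⁻ⁿ; Cauchy's estimate makes the convergence locally uniform on a complex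
cone, which gives analyticity.

Norm convergence also lets Gelfand characters of the bicommutant of Q pass to the limit, so that the
nonzero spectrum of the semigroup at time 1 consists of exponentials of spectral points of the
generator (`IsNegSectorial.spectrum_expInverse_one`). As σ(T) lies in Re z < -ω and the spectrum at
time 1 is compact, the spectral radius at time 1 is strictly below e^{-ω}. This is why the decay
rate is exactly ω, with no loss. -/

namespace DampedEquation

/-! ### Lower bounds and invertibility for the bounded pencil z²K + zS + 1. -/

section AbstractPencil

variable {E : Type*} [NormedAddCommGroup E] [InnerProductSpace ℂ E]

/-- Quantitative hypotheses on the coefficients of the pencil `z² K + z S + 1`. -/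
structure PencilBounds (K S : E →L[ℂ] E) (α β δ N ν : ℝ) : Prop where
  symm : ∀ x y, ⟪K x, y⟫_ℂ = ⟪x, K y⟫_ℂ
  nonneg : ∀ x, 0 ≤ (⟪x, K x⟫_ℂ).re
  alpha_le : ∀ x, α * ‖K x‖ ^ 2 ≤ (⟪x, S x⟫_ℂ).re
  beta_le : ∀ x, β * (⟪x, K x⟫_ℂ).re ≤ (⟪x, S x⟫_ℂ).re
  delta_le : ∀ x, δ * ‖x‖ ^ 2 ≤ (⟪x, S x⟫_ℂ).re
  norm_le : ‖S‖ ≤ N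
  im_le : ∀ x, |(⟪x, S x⟫_ℂ).im| ≤ ν * (⟪x, S x⟫_ℂ).re

/-- The bounded operator `z² K + z S + 1`. -/
def opPencil (K S : E →L[ℂ] E) (z : ℂ) : E →L[ℂ] E := z ^ 2 • K + z • S + 1

theorem opPencil_apply (K S : E →L[ℂ] E) (z : ℂ) (x : E) :
    opPencil K S z x = z ^ 2 • K x + z • S x + x := rfl

variable {K S : E →L[ℂ] E} {α β δ N ν : ℝ}

theorem PencilBounds.im_inner_eq_zero (h : PencilBounds K S α β δ N ν) (x : E) :
    (⟪x, K x⟫_ℂ).im = 0 := by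
  rw [← Complex.conj_eq_iff_im, inner_conj_symm, h.symm]

/-- The factor conj(z) removes the phase of the coefficient of S, so the real and imaginary parts of
⟪x, Sx⟫ enter separately. -/
theorem PencilBounds.conj_mul_inner (h : PencilBounds K S α β δ N ν) (z : ℂ) (x : E) :
    (starRingEnd ℂ z) * ⟪x, opPencil K S z x⟫_ℂ =
      ⟨‖z‖ ^ 2 * (z.re * (⟪x, K x⟫_ℂ).re + (⟪x, S x⟫_ℂ).re) + z.re * ‖x‖ ^ 2,
        ‖z‖ ^ 2 * (z.im * (⟪x, K x⟫_ℂ).re + (⟪x, S x⟫_ℂ).im) - z.im * ‖x‖ ^ 2⟩ := by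
  have him := h.im_inner_eq_zero x
  rw [opPencil_apply, inner_add_right, inner_add_right, inner_smul_right, inner_smul_right,
    inner_self_eq_norm_sq_to_K, Complex.sq_norm, Complex.normSq_apply]
  apply Complex.ext
  · simp [Complex.mul_re, sq, him, ← Complex.ofReal_mul]
    ring
  · simp [Complex.mul_re, sq, him, ← Complex.ofReal_mul]
    ring

theorem PencilBounds.abs_re_le (h : PencilBounds K S α β δ N ν) (z : ℂ) (x : E) :
    |‖z‖ ^ 2 * (z.re * (⟪x, K x⟫_ℂ).re + (⟪x, S x⟫_ℂ).re) + z.re * ‖x‖ ^ 2| ≤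
      ‖z‖ * (‖x‖ * ‖opPencil K S z x‖) := by
  have h1 := Complex.abs_re_le_norm ((starRingEnd ℂ z) * ⟪x, opPencil K S z x⟫_ℂ)
  rw [norm_mul, RCLike.norm_conj, h.conj_mul_inner] at h1
  exact h1.trans (mul_le_mul_of_nonneg_left (norm_inner_le_norm _ _) (norm_nonneg _))

theorem PencilBounds.abs_im_le (h : PencilBounds K S α β δ N ν) (z : ℂ) (x : E) :
    |‖z‖ ^ 2 * (z.im * (⟪x, K x⟫_ℂ).re + (⟪x, S x⟫_ℂ).im) - z.im * ‖x‖ ^ 2| ≤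
      ‖z‖ * (‖x‖ * ‖opPencil K S z x‖) := by
  have h1 := Complex.abs_im_le_norm ((starRingEnd ℂ z) * ⟪x, opPencil K S z x⟫_ℂ)
  rw [norm_mul, RCLike.norm_conj, h.conj_mul_inner] at h1
  exact h1.trans (mul_le_mul_of_nonneg_left (norm_inner_le_norm _ _) (norm_nonneg _))

/-- A uniform gap in the Cauchy-Schwarz inequality for two vectors which are separated by a
half space. -/
theorem re_inner_le_of_separated {x u s : E} (hδ : 0 < δ) (hN : 0 < N)
    (hu : (⟪x, u⟫_ℂ).re ≤ 0) (hs : δ * ‖x‖ ^ 2 ≤ (⟪x, s⟫_ℂ).re) (hsx : ‖s‖ ≤ N * ‖x‖) :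
    (⟪u, s⟫_ℂ).re ≤ (1 - δ ^ 2 / (2 * N ^ 2)) * (‖u‖ * ‖s‖) := by
  rcases eq_or_ne (‖u‖ * ‖s‖) 0 with h0 | h0
  · rw [h0, mul_zero]
    exact (Complex.re_le_norm _).trans ((norm_inner_le_norm u s).trans h0.le)
  have hus : 0 < ‖u‖ * ‖s‖ := lt_of_le_of_ne (by positivity) h0.symm
  have hs0 : 0 < ‖s‖ := pos_of_mul_pos_right hus (norm_nonneg _)
  have hx : 0 < ‖x‖ := by
    by_contra hx
    have : ‖x‖ = 0 := le_antisymm (not_lt.mp hx) (norm_nonneg _)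
    rw [this, mul_zero] at hsx
    linarith
  -- The norm of w measures the defect in the Cauchy-Schwarz inequality for u and s. Testing w
  -- against x bounds it below, because both terms of Re ⟪x, w⟫ are nonnegative.
  set w : E := (‖u‖ : ℂ) • s - (‖s‖ : ℂ) • u with hw
  have h1 : ‖u‖ * (δ * ‖x‖ ^ 2) ≤ ‖x‖ * ‖w‖ := by
    have h2 : (⟪x, w⟫_ℂ).re = ‖u‖ * (⟪x, s⟫_ℂ).re - ‖s‖ * (⟪x, u⟫_ℂ).re := by
      rw [hw, inner_sub_right, inner_smul_right, inner_smul_right]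
      simp
    have h3 := (Complex.re_le_norm _).trans (norm_inner_le_norm (𝕜 := ℂ) x w)
    rw [h2] at h3
    have h4 := mul_le_mul_of_nonneg_left hs (norm_nonneg u)
    nlinarith
  have h2 : ‖u‖ * (δ * ‖x‖) ≤ ‖w‖ := by
    refine le_of_mul_le_mul_left ?_ hx
    linarith
  have h3 : δ * (‖u‖ * ‖s‖) ≤ N * ‖w‖ := by
    have h4 := mul_le_mul_of_nonneg_left hsx (mul_nonneg (norm_nonneg u) hδ.le)
    have h5 := mul_le_mul_of_nonneg_left h2 hN.le
    linarith
  have h4 : ‖w‖ ^ 2 = 2 * (‖u‖ * ‖s‖) * (‖u‖ * ‖s‖ - (⟪u, s⟫_ℂ).re) := by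
    have h5 := norm_sub_sq (𝕜 := ℂ) ((‖u‖ : ℂ) • s) ((‖s‖ : ℂ) • u)
    have h6 : (⟪s, u⟫_ℂ).re = (⟪u, s⟫_ℂ).re := inner_re_symm (𝕜 := ℂ) s u
    rw [← hw, inner_smul_left, inner_smul_right, norm_smul, norm_smul] at h5
    simp only [Complex.norm_real, norm_norm, RCLike.re_to_complex, Complex.conj_ofReal,
      Complex.re_ofReal_mul, h6] at h5
    rw [h5]
    ring
  have h5 : δ ^ 2 * (‖u‖ * ‖s‖) ^ 2 ≤ N ^ 2 * ‖w‖ ^ 2 := by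
    have := pow_le_pow_left₀ (by positivity) h3 2
    rwa [mul_pow, mul_pow _ ‖w‖] at this
  rw [h4] at h5
  have h6 : δ ^ 2 * (‖u‖ * ‖s‖) ≤ N ^ 2 * (2 * (‖u‖ * ‖s‖ - (⟪u, s⟫_ℂ).re)) := by
    refine le_of_mul_le_mul_left ?_ hus
    linarith
  have h7 : δ ^ 2 / (2 * N ^ 2) * (‖u‖ * ‖s‖) ≤ ‖u‖ * ‖s‖ - (⟪u, s⟫_ℂ).re := by
    rw [div_mul_eq_mul_div, div_le_iff₀ (by positivity)]
    linarith
  linarith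

/-- The nested radical in the decay rate is the square of the positive root of a quadratic equation;
only this equation is needed in the estimates. -/
theorem decayRate_eq (hα : 0 < α) (hδ : 0 < δ) (hN : 0 < N) :
    ∃ y : ℝ, 0 < y ∧ y ^ 2 = 1 / (√α * √δ) + N / √δ * y ∧
      decayRate α β δ N = (1 / β + y ^ 2)⁻¹ := by
  have ha : 0 < √α := Real.sqrt_pos.mpr hα
  have hd : 0 < √δ := Real.sqrt_pos.mpr hδ
  set p := 1 / (√α * √δ) with hp
  set g := N / √δ with hg
  have hp0 : 0 < p := by positivity
  have hg0 : 0 < g := by positivity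
  have hr : √(g ^ 2 + 4 * p) ^ 2 = g ^ 2 + 4 * p := Real.sq_sqrt (by positivity)
  have hy : ((g + √(g ^ 2 + 4 * p)) / 2) ^ 2 = p + g * ((g + √(g ^ 2 + 4 * p)) / 2) := by
    linear_combination hr / 4
  refine ⟨(g + √(g ^ 2 + 4 * p)) / 2, by positivity, hy, ?_⟩
  have hg2 : N ^ 2 / δ = g ^ 2 := by rw [hg, div_pow, Real.sq_sqrt hδ.le]
  have h1 : 4 * N ^ 2 / (δ * √(α * δ)) + N ^ 4 / δ ^ 2 = g ^ 2 * (g ^ 2 + 4 * p) := by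
    rw [← hg2, hp, Real.sqrt_mul hα.le]
    field_simp
    ring
  have h2 : N ^ 2 / (2 * δ) = g ^ 2 / 2 := by rw [← hg2]; field_simp
  rw [hy, decayRate, h1, h2, Real.sqrt_mul hα.le, ← hp, Real.sqrt_mul (by positivity),
    Real.sqrt_sq hg0.le]
  congr 1
  ring

/-- Two bounds on ‖x‖² compete: R/δ, good for large |z|, and |z|²‖zKx + Sx‖² ≤ |z|²(|z|/√α +
N/√δ)²R, good for small |z|. They cross at |z| = 1/(y√δ), where both equal |z|²y²R; this determines
y. -/
theorem PencilBounds.norm_sq_le_of_slack (h : PencilBounds K S α β δ N ν) (hα : 0 < α)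
    (hδ : 0 < δ) (hδN : δ ≤ N) {y : ℝ} (hy : 0 < y)
    (hy2 : y ^ 2 = 1 / (√α * √δ) + N / √δ * y) {z : ℂ} (hz : z ≠ 0) (hz0 : z.re ≤ 0) :
    ∃ η : ℝ, 0 < η ∧ ∀ x, ‖x‖ ^ 2 ≤
      ‖z‖ ^ 2 * (y ^ 2 - η) * (⟪x, S x⟫_ℂ).re + 2 * (‖x‖ * ‖opPencil K S z x‖) := by
  have hN : 0 < N := hδ.trans_le hδN
  have ha : 0 < √α := Real.sqrt_pos.mpr hα
  have hd : 0 < √δ := Real.sqrt_pos.mpr hδ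
  have ha2 : √α ^ 2 = α := Real.sq_sqrt hα.le
  have hd2 : √δ ^ 2 = δ := Real.sq_sqrt hδ.le
  have hρ : 0 < ‖z‖ := norm_pos_iff.mpr hz
  rcases lt_or_ge 1 (‖z‖ * y * √δ) with hc | hc
  · refine ⟨y ^ 2 - 1 / (δ * ‖z‖ ^ 2), ?_, fun x => ?_⟩
    · rw [sub_pos, div_lt_iff₀ (by positivity)]
      have := pow_lt_pow_left₀ hc zero_le_one two_ne_zero
      rw [mul_pow, mul_pow, hd2] at this
      linarith
    · have h1 : ‖z‖ ^ 2 * (y ^ 2 - (y ^ 2 - 1 / (δ * ‖z‖ ^ 2))) = 1 / δ := by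
        field_simp
        ring
      rw [h1, one_div_mul_eq_div]
      have h2 : ‖x‖ ^ 2 ≤ (⟪x, S x⟫_ℂ).re / δ := by
        rw [le_div_iff₀ hδ, mul_comm]
        exact h.delta_le x
      have : 0 ≤ 2 * (‖x‖ * ‖opPencil K S z x‖) := by positivity
      linarith
  -- At the crossing point the triangle inequality alone gives η = 0. Since Re ⟪x, zKx⟫ ≤ 0 while Re
  -- ⟪x, Sx⟫ ≥ δ‖x‖², the vectors zKx and Sx are not aligned, and κ quantifies the gain.
  · set κ := δ ^ 2 / (2 * N ^ 2) with hκ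
    have hκ0 : 0 < κ := by positivity
    refine ⟨2 * κ * ((‖z‖ / √α) * (N / √δ)), by positivity, fun x => ?_⟩
    set R := (⟪x, S x⟫_ℂ).re with hR
    have hR0 : 0 ≤ R := le_trans (by positivity) (h.delta_le x)
    set r := √R with hr
    have hr2 : r ^ 2 = R := Real.sq_sqrt hR0
    have hr0 : 0 ≤ r := Real.sqrt_nonneg _
    set u := z • K x with hu
    have hsx : ‖S x‖ ≤ N * ‖x‖ :=
      ((S).le_opNorm x).trans (mul_le_mul_of_nonneg_right h.norm_le (norm_nonneg _))
    have hxr : √δ * ‖x‖ ≤ r := by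
      apply Real.le_sqrt_of_sq_le
      rw [mul_pow, hd2]
      exact h.delta_le x
    have hun : ‖u‖ ≤ ‖z‖ / √α * r := by
      have h1 : √α * ‖K x‖ ≤ r := by
        apply Real.le_sqrt_of_sq_le
        rw [mul_pow, ha2]
        exact h.alpha_le x
      rw [hu, norm_smul, div_mul_eq_mul_div, le_div_iff₀ ha]
      linarith [mul_le_mul_of_nonneg_left h1 hρ.le]
    have hsn : ‖S x‖ ≤ N / √δ * r := by
      rw [div_mul_eq_mul_div, le_div_iff₀ hd]
      linarith [mul_le_mul_of_nonneg_left hxr hN.le, mul_le_mul_of_nonneg_right hsx hd.le]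
    have hang : (⟪u, S x⟫_ℂ).re ≤ (1 - κ) * (‖u‖ * ‖S x‖) := by
      refine re_inner_le_of_separated hδ hN ?_ (h.delta_le x) hsx
      rw [hu, inner_smul_right, Complex.mul_re, h.im_inner_eq_zero, mul_zero, sub_zero]
      exact mul_nonpos_of_nonpos_of_nonneg hz0 (h.nonneg x)
    set a := ‖z‖ / √α with hadef
    set b := N / √δ with hbdef
    have ha0 : 0 < a := by positivity
    have hb0 : 0 < b := by positivity
    have hx1 : ‖x - opPencil K S z x‖ ^ 2 = ‖z‖ ^ 2 * ‖u + S x‖ ^ 2 := by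
      have : x - opPencil K S z x = -(z • (u + S x)) := by
        rw [opPencil_apply, hu, smul_add, smul_smul, sq]
        abel
      rw [this, norm_neg, norm_smul, mul_pow]
    have h2 : ‖u + S x‖ ^ 2 ≤ ((a + b) ^ 2 - 2 * κ * (a * b)) * R := by
      have h3 := norm_add_sq (𝕜 := ℂ) u (S x)
      simp only [RCLike.re_to_complex] at h3
      have h4 : ‖u‖ ^ 2 ≤ (a * r) ^ 2 := pow_le_pow_left₀ (norm_nonneg _) hun 2
      have h5 : ‖S x‖ ^ 2 ≤ (b * r) ^ 2 := pow_le_pow_left₀ (norm_nonneg _) hsn 2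
      have h6 : (⟪u, S x⟫_ℂ).re ≤ (1 - κ) * ((a * r) * (b * r)) := by
        refine hang.trans (mul_le_mul_of_nonneg_left
          (mul_le_mul hun hsn (norm_nonneg _) (by positivity)) ?_)
        rw [sub_nonneg, hκ, div_le_one (by positivity)]
        have := pow_le_pow_left₀ hδ.le hδN 2
        linarith [sq_nonneg N]
      rw [h3]
      have : ((a + b) ^ 2 - 2 * κ * (a * b)) * R =
          (a * r) ^ 2 + 2 * ((1 - κ) * ((a * r) * (b * r))) + (b * r) ^ 2 := by
        rw [← hr2]; ring
      rw [this]
      linarith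
    have h3 : a + b ≤ y := by
      have h4 : a * y ≤ 1 / (√α * √δ) := by
        rw [hadef, div_mul_eq_mul_div, div_le_div_iff₀ ha (by positivity)]
        linarith [mul_le_mul_of_nonneg_left hc ha.le]
      refine le_of_mul_le_mul_right ?_ hy
      linarith
    have h4 : ‖u + S x‖ ^ 2 ≤ (y ^ 2 - 2 * κ * (a * b)) * R := by
      refine h2.trans (mul_le_mul_of_nonneg_right ?_ hR0)
      have := pow_le_pow_left₀ (by positivity) h3 2
      linarith
    have h5 : ‖x‖ ^ 2 ≤ ‖x - opPencil K S z x‖ ^ 2 + 2 * (‖x‖ * ‖opPencil K S z x‖) := by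
      have h6 := norm_sub_sq (𝕜 := ℂ) x (opPencil K S z x)
      have h7 := (RCLike.re_le_norm (⟪x, opPencil K S z x⟫_ℂ)).trans
        (norm_inner_le_norm x (opPencil K S z x))
      linarith [sq_nonneg ‖opPencil K S z x‖]
    rw [hx1] at h5
    have h6 := mul_le_mul_of_nonneg_left h4 (sq_nonneg ‖z‖)
    linarith

theorem PencilBounds.exists_norm_le_of_neg_decayRate_le (h : PencilBounds K S α β δ N ν)
    (hα : 0 < α) (hβ : 0 < β) (hδ : 0 < δ) (hδN : δ ≤ N) {z : ℂ}
    (hz : -decayRate α β δ N ≤ z.re) : ∃ C : ℝ, ∀ x, ‖x‖ ≤ C * ‖opPencil K S z x‖ := by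
  rcases eq_or_ne z 0 with rfl | hz0
  · exact ⟨1, fun x => by simp [opPencil_apply]⟩
  have hρ : 0 < ‖z‖ := norm_pos_iff.mpr hz0
  -- R dominates δ‖x‖², so bounding R by the residual and cancelling one factor ‖x‖ is enough.
  suffices H : ∃ c : ℝ, 0 < c ∧ ∃ C : ℝ, ∀ x,
      c * (⟪x, S x⟫_ℂ).re ≤ C * (‖x‖ * ‖opPencil K S z x‖) by
    obtain ⟨c, hc, C, H⟩ := H
    refine ⟨C / (c * δ), fun x => ?_⟩
    rcases eq_or_ne x 0 with rfl | hx
    · simp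
    rw [div_mul_eq_mul_div, le_div_iff₀ (by positivity)]
    refine le_of_mul_le_mul_left ?_ (norm_pos_iff.mpr hx)
    linarith [H x, mul_le_mul_of_nonneg_left (h.delta_le x) hc.le]
  rcases le_or_gt 0 z.re with hr | hr
  · refine ⟨‖z‖ ^ 2, by positivity, ‖z‖, fun x => ?_⟩
    have h1 := (le_abs_self _).trans (h.abs_re_le z x)
    have h2 : 0 ≤ ‖z‖ ^ 2 * (z.re * (⟪x, K x⟫_ℂ).re) :=
      mul_nonneg (sq_nonneg _) (mul_nonneg hr (h.nonneg x))
    have h3 : 0 ≤ z.re * ‖x‖ ^ 2 := by positivity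
    linarith
  · obtain ⟨y, hy, hy2, hω⟩ := decayRate_eq (β := β) hα hδ (hδ.trans_le hδN)
    obtain ⟨η, hη, hs⟩ := h.norm_sq_le_of_slack hα hδ hδN hy hy2 hz0 hr.le
    obtain ⟨r, hrz⟩ : ∃ r, r = -z.re := ⟨_, rfl⟩
    have hr0 : 0 < r := by linarith
    refine ⟨r * η * ‖z‖ ^ 2, by positivity, 2 * r + ‖z‖, fun x => ?_⟩
    have h1 := (le_abs_self _).trans (h.abs_re_le z x)
    have h2 : r * (1 / β + y ^ 2) ≤ 1 := by
      rw [hω] at hz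
      have : r ≤ (1 / β + y ^ 2)⁻¹ := by linarith
      rwa [← one_div, le_div_iff₀ (by positivity)] at this
    have h3 : (⟪x, K x⟫_ℂ).re ≤ 1 / β * (⟪x, S x⟫_ℂ).re := by
      rw [one_div_mul_eq_div, le_div_iff₀ hβ, mul_comm]
      exact h.beta_le x
    have h4 := mul_le_mul_of_nonneg_left (hs x) hr0.le
    have h5 := mul_le_mul_of_nonneg_left h3 (mul_nonneg hr0.le (sq_nonneg ‖z‖))
    have hR0 : 0 ≤ (⟪x, S x⟫_ℂ).re := le_trans (by positivity) (h.delta_le x)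
    have h6 := mul_le_mul_of_nonneg_right h2 (mul_nonneg (sq_nonneg ‖z‖) hR0)
    have h7 : z.re = -r := by linarith
    rw [h7] at h1
    linarith

/-- With u = ‖x‖²/|z|² and v = ⟪x, Kx⟫, the real part gives R ≲ r(u + v) and the imaginary part
gives |Im z||u - v| ≲ νR. If (|Im z| - b)(u + v) ≲ MR also holds, then |Im z| > Mr + b forces R to
be bounded by the residual. -/
theorem PencilBounds.exists_norm_le_of_slope_lt (h : PencilBounds K S α β δ N ν)
    (hβ : 0 < β) (hδ : 0 < δ) (hν : 0 < ν) {θ b : ℝ} (hb : 0 ≤ b) (hθ : 0 < θ)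
    (hbθ : b ^ 2 ≤ θ) {z : ℂ} (hr : z.re < 0)
    (hz : slope ν β δ θ b * |z.re| + b < |z.im|) :
    ∃ C : ℝ, ∀ x, ‖x‖ ≤ C * ‖opPencil K S z x‖ := by
  obtain ⟨r, hrz⟩ : ∃ r, r = -z.re := ⟨_, rfl⟩
  have hr0 : 0 < r := by linarith
  rw [abs_of_neg hr, ← hrz] at hz
  obtain ⟨s, hs⟩ : ∃ s, s = |z.im| := ⟨_, rfl⟩
  rw [← hs] at hz
  obtain ⟨t, ht⟩ : ∃ t, t = √θ := ⟨_, rfl⟩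
  have ht0 : 0 < t := ht ▸ Real.sqrt_pos.mpr hθ
  have ht2 : t ^ 2 = θ := ht ▸ Real.sq_sqrt hθ.le
  have hbt : b ≤ t := ht ▸ Real.le_sqrt_of_sq_le hbθ
  -- The positive root of s₀² = b s₀ + θ; the middle term of the slope is 1/(δ s₀).
  obtain ⟨s₀, hs₀⟩ : ∃ s₀, s₀ = (b + √(b ^ 2 + 4 * θ)) / 2 := ⟨_, rfl⟩
  have hw : √(b ^ 2 + 4 * θ) ^ 2 = b ^ 2 + 4 * θ := Real.sq_sqrt (by positivity)
  have hw0 : 0 < √(b ^ 2 + 4 * θ) := Real.sqrt_pos.mpr (by positivity)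
  have hs₀0 : 0 < s₀ := by rw [hs₀]; positivity
  have hs₀2 : s₀ ^ 2 = b * s₀ + t ^ 2 := by
    rw [hs₀, ht2]
    linear_combination hw / 4
  have hs₀t : t ≤ s₀ := by nlinarith
  obtain ⟨M, hM⟩ : ∃ M, M = slope ν β δ θ b := ⟨_, rfl⟩
  have hM' : M = ν + 1 / (δ * s₀) + (t - b) / β := by
    rw [hM, slope, hs₀, ← ht]
    congr 2
    field_simp
  rw [← hM] at hz
  have hM0 : 0 < M := by
    rw [hM']
    have : 0 ≤ (t - b) / β := div_nonneg (by linarith) hβ.le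
    positivity
  have hsb : b < s := by nlinarith
  have hs0 : 0 < s := hb.trans_lt hsb
  have hz0 : z ≠ 0 := by
    rintro rfl
    simp at hr
  have hρ : 0 < ‖z‖ := norm_pos_iff.mpr hz0
  have hsρ : s ^ 2 ≤ ‖z‖ ^ 2 := by
    rw [hs, sq_abs, Complex.sq_norm, Complex.normSq_apply]
    nlinarith
  have key : ∀ u v R e : ℝ, 0 ≤ u → 0 ≤ v → 0 ≤ e → v ≤ R / β → u ≤ R / (δ * s ^ 2) →
      s * |u - v| ≤ ν * R + e → 0 ≤ R →
      (s - b) * (u + v) ≤ M * R + e := by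
    intro u v R e hu hv he hvR huR huv hR
    -- The parameter τ decides how much of s(u + v) is charged to s|u - v|, and how the remainder is
    -- split between u and v.
    have hid : ∀ τ : ℝ, |τ| ≤ 1 → (s - b) * (u + v) ≤
        ν * R + e + (s - b - τ * s) * u + (s - b + τ * s) * v := by
      intro τ hτ
      have h1 : τ * (s * (u - v)) ≤ s * |u - v| := by
        have h2 := le_abs_self (τ * (s * (u - v)))
        rw [abs_mul, abs_mul, abs_of_pos hs0] at h2
        exact h2.trans (mul_le_of_le_one_left (by positivity) hτ)
      linarith
    have hvt : (t - b) * v ≤ (t - b) / β * R := by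
      have := mul_le_mul_of_nonneg_left hvR (sub_nonneg.mpr hbt)
      rwa [mul_div_assoc', mul_div_right_comm] at this
    have hMR : M * R = ν * R + 1 / (δ * s₀) * R + (t - b) / β * R := by rw [hM']; ring
    have hp : 0 ≤ 1 / (δ * s₀) * R := by positivity
    rcases le_or_gt t (2 * s) with hts | hts
    -- This τ makes the coefficient of v equal to √θ - b, which produces the last term of the slope.
    · have h1 := hid (t / s - 1) (by
        rw [abs_le]
        constructor
        · have : 0 ≤ t / s := by positivity
          linarith
        · rw [sub_le_iff_le_add, div_le_iff₀ hs0]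
          linarith)
      have h2 : (t / s - 1) * s = t - s := by field_simp
      rw [h2] at h1
      have h3 : (s - b - (t - s)) * u ≤ 1 / (δ * s₀) * R := by
        rcases le_or_gt (s - b - (t - s)) 0 with h4 | h4
        · exact (mul_nonpos_of_nonpos_of_nonneg h4 hu).trans hp
        · refine (mul_le_mul_of_nonneg_left huR h4.le).trans ?_
          rw [mul_div_assoc', one_div_mul_eq_div, div_le_div_iff₀ (by positivity) (by positivity)]
          -- By the equation for s₀ the difference of the two sides is (s - s₀)² + t(s₀ - t), and t
          -- ≤ s₀.
          have h5 : (s - b - (t - s)) * s₀ ≤ s ^ 2 := by nlinarith [sq_nonneg (s - s₀)]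
          have := mul_le_mul_of_nonneg_left h5 (mul_nonneg hδ.le hR)
          linarith
      linarith
    -- For 2s < t the previous τ would be larger than 1. With τ = 1 the coefficient of u is -b ≤ 0
    -- and that of v is 2s - b < t - b.
    · have h1 := hid 1 (by simp)
      have h3 : (s - b + 1 * s) * v ≤ (t - b) * v := mul_le_mul_of_nonneg_right (by linarith) hv
      have h4 : 0 ≤ b * u := mul_nonneg hb hu
      linarith
  obtain ⟨g, hg⟩ : ∃ g, g = (s - b) / r - M := ⟨_, rfl⟩
  have hg0 : 0 < g := by
    rw [hg, sub_pos, lt_div_iff₀ hr0]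
    linarith
  refine ⟨(1 + (s - b) / r) / (‖z‖ * g * δ), fun x => ?_⟩
  rcases eq_or_ne x 0 with rfl | hx
  · simp
  have hxp : 0 < ‖x‖ := norm_pos_iff.mpr hx
  set R := (⟪x, S x⟫_ℂ).re with hR
  set v := (⟪x, K x⟫_ℂ).re with hv
  set e := ‖x‖ * ‖opPencil K S z x‖ / ‖z‖ with he
  set u := ‖x‖ ^ 2 / ‖z‖ ^ 2 with hu
  have hR0 : 0 ≤ R := le_trans (by positivity) (h.delta_le x)
  have huz : ‖z‖ ^ 2 * u = ‖x‖ ^ 2 := by rw [hu]; field_simp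
  have hez : ‖z‖ ^ 2 * e = ‖z‖ * (‖x‖ * ‖opPencil K S z x‖) := by rw [he]; field_simp
  have hz2 : 0 < ‖z‖ ^ 2 := by positivity
  have hre : R - e ≤ r * (u + v) := by
    have h1 := (le_abs_self _).trans (h.abs_re_le z x)
    rw [← hR, ← hv, ← hez, ← huz] at h1
    have h2 : z.re = -r := by linarith
    rw [h2] at h1
    refine le_of_mul_le_mul_left ?_ hz2
    linarith
  have him : s * |u - v| ≤ ν * R + e := by
    have h1 := h.abs_im_le z x
    rw [← hv, ← hez, ← huz] at h1
    have h2 : ‖z‖ ^ 2 * (z.im * v + (⟪x, S x⟫_ℂ).im) - z.im * (‖z‖ ^ 2 * u) =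
        ‖z‖ ^ 2 * ((⟪x, S x⟫_ℂ).im - z.im * (u - v)) := by ring
    rw [h2, abs_mul, abs_of_pos hz2] at h1
    have h3 := le_of_mul_le_mul_left h1 hz2
    have h4 := abs_sub_abs_le_abs_sub (z.im * (u - v)) (⟪x, S x⟫_ℂ).im
    rw [abs_sub_comm, abs_mul, ← hs] at h4
    linarith [h.im_le x]
  have h1 := key u v R e (by positivity) (h.nonneg x) (by positivity)
    (by rw [le_div_iff₀ hβ, mul_comm]; exact h.beta_le x)
    (by
      rw [hu, div_le_div_iff₀ hz2 (by positivity)]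
      have h2 := mul_le_mul_of_nonneg_left hsρ (mul_nonneg hδ.le (sq_nonneg ‖x‖))
      have h3 := mul_le_mul_of_nonneg_right (h.delta_le x) hz2.le
      linarith) him hR0
  have h2 : g * R ≤ (1 + (s - b) / r) * e := by
    have h3 : (s - b) / r * (R - e) ≤ (s - b) * (u + v) := by
      rw [div_mul_eq_mul_div, div_le_iff₀ hr0]
      have := mul_le_mul_of_nonneg_left hre (sub_nonneg.mpr hsb.le)
      linarith
    rw [hg]
    linarith
  have h3 := mul_le_mul_of_nonneg_left (h.delta_le x) hg0.le
  rw [div_mul_eq_mul_div, le_div_iff₀ (by positivity)]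
  have h4 : g * (δ * ‖x‖ ^ 2) * ‖z‖ ≤
      (1 + (s - b) / r) * (‖x‖ * ‖opPencil K S z x‖) := by
    have h5 := mul_le_mul_of_nonneg_right (h3.trans h2) hρ.le
    refine h5.trans (le_of_eq ?_)
    rw [he]
    field_simp
  refine le_of_mul_le_mul_left ?_ hxp
  linarith

variable [CompleteSpace E]

/-- The hypotheses involve S only through its norm, Re ⟪x, Sx⟫ and |Im ⟪x, Sx⟫|, none of which
changes under S ↦ S*. -/
theorem PencilBounds.adjoint (h : PencilBounds K S α β δ N ν) :
    PencilBounds K (ContinuousLinearMap.adjoint S) α β δ N ν := by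
  have hre : ∀ x, (⟪x, ContinuousLinearMap.adjoint S x⟫_ℂ).re = (⟪x, S x⟫_ℂ).re := fun x => by
    rw [ContinuousLinearMap.adjoint_inner_right]
    exact inner_re_symm (𝕜 := ℂ) _ _
  have him : ∀ x, (⟪x, ContinuousLinearMap.adjoint S x⟫_ℂ).im = -(⟪x, S x⟫_ℂ).im := fun x => by
    rw [ContinuousLinearMap.adjoint_inner_right]
    exact inner_im_symm (𝕜 := ℂ) _ _
  refine ⟨h.symm, h.nonneg, fun x => ?_, fun x => ?_, fun x => ?_, ?_, fun x => ?_⟩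
  · rw [hre]; exact h.alpha_le x
  · rw [hre]; exact h.beta_le x
  · rw [hre]; exact h.delta_le x
  · rw [LinearIsometryEquiv.norm_map]; exact h.norm_le
  · rw [hre, him, abs_neg]; exact h.im_le x

theorem PencilBounds.inner_opPencil (h : PencilBounds K S α β δ N ν) (z : ℂ) (x y : E) :
    ⟪opPencil K (ContinuousLinearMap.adjoint S) (starRingEnd ℂ z) x, y⟫_ℂ = ⟪x, opPencil K S z y⟫_ℂ := by
  simp only [opPencil_apply, inner_add_left, inner_add_right, inner_smul_left, inner_smul_right,
    h.symm, ContinuousLinearMap.adjoint_inner_left, map_pow, Complex.conj_conj]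

/-- A pencil which is bounded below along with its adjoint is invertible. -/
theorem PencilBounds.isUnit_of_norm_le (h : PencilBounds K S α β δ N ν) {z : ℂ}
    (h₁ : ∃ C : ℝ, ∀ x, ‖x‖ ≤ C * ‖opPencil K S z x‖)
    (h₂ : ∃ C : ℝ, ∀ x,
      ‖x‖ ≤ C * ‖opPencil K (ContinuousLinearMap.adjoint S) (starRingEnd ℂ z) x‖) :
    IsUnit (opPencil K S z) := by
  obtain ⟨C, hC⟩ := h₁
  obtain ⟨C', hC'⟩ := h₂
  rw [ContinuousLinearMap.isUnit_iff_bijective,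
    ContinuousLinearMap.bijective_iff_dense_range_and_antilipschitz]
  refine ⟨?_, C.toNNReal, ?_⟩
  · rw [Submodule.topologicalClosure_eq_top_iff, Submodule.eq_bot_iff]
    intro x hx
    have h3 : opPencil K (ContinuousLinearMap.adjoint S) (starRingEnd ℂ z) x = 0 := by
      rw [← inner_self_eq_zero (𝕜 := ℂ), h.inner_opPencil]
      exact (Submodule.mem_orthogonal' _ _).mp hx _ ⟨_, rfl⟩
    have h4 := hC' x
    rw [h3, norm_zero, mul_zero] at h4
    exact norm_le_zero_iff.mp h4
  · refine (opPencil K S z).antilipschitz_of_bound fun x => (hC x).trans ?_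
    exact mul_le_mul_of_nonneg_right (Real.le_coe_toNNReal C) (norm_nonneg _)

theorem PencilBounds.isUnit_of_neg_decayRate_le (h : PencilBounds K S α β δ N ν)
    (hα : 0 < α) (hβ : 0 < β) (hδ : 0 < δ) (hδN : δ ≤ N) {z : ℂ}
    (hz : -decayRate α β δ N ≤ z.re) : IsUnit (opPencil K S z) :=
  h.isUnit_of_norm_le (h.exists_norm_le_of_neg_decayRate_le hα hβ hδ hδN hz)
    (h.adjoint.exists_norm_le_of_neg_decayRate_le hα hβ hδ hδN (by simpa using hz))

theorem PencilBounds.isUnit_of_slope_lt (h : PencilBounds K S α β δ N ν)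
    (hβ : 0 < β) (hδ : 0 < δ) (hν : 0 < ν) {θ b : ℝ} (hb : 0 ≤ b) (hθ : 0 < θ)
    (hbθ : b ^ 2 ≤ θ) {z : ℂ} (hr : z.re < 0)
    (hz : slope ν β δ θ b * |z.re| + b < |z.im|) : IsUnit (opPencil K S z) :=
  h.isUnit_of_norm_le (h.exists_norm_le_of_slope_lt hβ hδ hν hb hθ hbθ hr hz)
    (h.adjoint.exists_norm_le_of_slope_lt hβ hδ hν hb hθ hbθ (by simpa using hr)
      (by simpa using hz))

end AbstractPencil

/-! ### Attainment of the minimal slope. -/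

section Slope

/-- The slope tends to infinity as θ → ∞. The lower end θ = b² is admissible when b > 0, and for b =
0 the term 1/(δ√θ) blows up at 0. A compact interval therefore suffices, with comparison value m
taken at θ = b² + 1. -/
theorem exists_isLeast_slope {ν β δ b : ℝ} (hβ : 0 < β) (hδ : 0 < δ) (hb : 0 ≤ b) :
    ∃ M : ℝ, IsLeast ((fun θ => slope ν β δ θ b) '' {θ : ℝ | 0 < θ ∧ b ^ 2 ≤ θ}) M := by
  obtain ⟨m, hm⟩ : ∃ m, m = slope ν β δ (b ^ 2 + 1) b := ⟨_, rfl⟩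
  have hpos : ∀ θ : ℝ, 0 < θ → 0 < 2 / (δ * (b + √(b ^ 2 + 4 * θ))) := fun θ hθ => by
    have := Real.sqrt_pos.mpr (show 0 < b ^ 2 + 4 * θ by positivity)
    positivity
  obtain ⟨lo, hlo, hlob, hlo1, hlom⟩ : ∃ lo : ℝ, 0 < lo ∧ b ^ 2 ≤ lo ∧ lo ≤ b ^ 2 + 1 ∧
      ∀ θ : ℝ, 0 < θ → b ^ 2 ≤ θ → θ ≤ lo → θ = lo ∨ m ≤ slope ν β δ θ b := by
    rcases hb.eq_or_lt with rfl | hb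
    · obtain ⟨c, hc⟩ : ∃ c, c = min 1 (1 / (δ * (|m - ν| + 1))) := ⟨_, rfl⟩
      have hc0 : 0 < c := by rw [hc]; positivity
      have hc1 : c ≤ 1 := hc ▸ min_le_left _ _
      have hc2 : c * (δ * (|m - ν| + 1)) ≤ 1 := by
        rw [← le_div_iff₀ (by positivity)]
        exact hc ▸ min_le_right _ _
      refine ⟨c ^ 2, by positivity, by rw [zero_pow two_ne_zero]; positivity, by nlinarith, fun θ hθ _ hθc => Or.inr ?_⟩
      have h1 : √θ ≤ c := Real.sqrt_le_iff.mpr ⟨hc0.le, hθc⟩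
      have h2 : 0 < √θ := Real.sqrt_pos.mpr hθ
      have h3 : √(0 ^ 2 + 4 * θ) = 2 * √θ := by
        rw [show (0 : ℝ) ^ 2 + 4 * θ = 2 ^ 2 * θ by ring, Real.sqrt_mul (by positivity),
          Real.sqrt_sq (by positivity)]
      have h4 : |m - ν| + 1 ≤ 2 / (δ * (0 + √(0 ^ 2 + 4 * θ))) := by
        rw [h3, le_div_iff₀ (by positivity)]
        have h6 := mul_le_mul_of_nonneg_left h1
          (show 0 ≤ (|m - ν| + 1) * δ by positivity)
        linarith
      have h5 : 0 ≤ (√θ - 0) / β := by rw [sub_zero]; positivity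
      have h6 := le_abs_self (m - ν)
      rw [slope]
      linarith
    · exact ⟨b ^ 2, by positivity, le_rfl, by linarith, fun θ _ h1 h2 => Or.inl (le_antisymm h2 h1)⟩
  obtain ⟨hi, hhi, hhim⟩ : ∃ hi : ℝ, max lo (b ^ 2 + 1) ≤ hi ∧
      ∀ θ : ℝ, hi ≤ θ → m ≤ slope ν β δ θ b := by
    refine ⟨max (max lo (b ^ 2 + 1)) ((b + β * |m - ν|) ^ 2), le_max_left _ _, fun θ hθ => ?_⟩
    have h0 : 0 < θ := hlo.trans_le (((le_max_left _ _).trans (le_max_left _ _)).trans hθ)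
    have h1 : b + β * |m - ν| ≤ √θ := Real.le_sqrt_of_sq_le ((le_max_right _ _).trans hθ)
    have h2 : |m - ν| ≤ (√θ - b) / β := by
      rw [le_div_iff₀ hβ]
      linarith
    rw [slope]
    linarith [le_abs_self (m - ν), hpos θ h0]
  have hcont : ContinuousOn (fun θ => slope ν β δ θ b) (Set.Icc lo hi) := by
    unfold slope
    refine ContinuousOn.add (ContinuousOn.add continuousOn_const
      (ContinuousOn.div continuousOn_const (by fun_prop) fun θ hθ h0 => ?_)) (by fun_prop)
    have h1 := hpos θ (hlo.trans_le hθ.1)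
    rw [h0, div_zero] at h1
    exact lt_irrefl _ h1
  have hlohi : lo ≤ hi := (le_max_left _ _).trans hhi
  obtain ⟨θ₀, hθ₀, hmin⟩ := isCompact_Icc.exists_isMinOn ⟨lo, le_rfl, hlohi⟩ hcont
  have h0m : slope ν β δ θ₀ b ≤ m := by
    rw [hm]
    exact hmin ⟨hlo1, (le_max_right _ _).trans hhi⟩
  refine ⟨_, ⟨θ₀, ⟨hlo.trans_le hθ₀.1, hlob.trans hθ₀.1⟩, rfl⟩, ?_⟩
  rintro _ ⟨θ, ⟨hθ, hbθ⟩, rfl⟩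
  rcases le_or_gt θ lo with h1 | h1
  · rcases hlom θ hθ hbθ h1 with h2 | h2
    · exact hmin ⟨h2.ge, h2.le.trans hlohi⟩
    · exact h0m.trans h2
  · rcases le_or_gt θ hi with h2 | h2
    · exact hmin ⟨h1.le, h2⟩
    · exact h0m.trans (hhim θ h2.le)

end Slope


/-! ### Norm estimates for exponentials of bounded operators. -/

section Exponentials

open NormedSpace Filter

/-- Interpolation along exp(sa)exp((1 - s)b)c, whose derivative is a product of contractions with (a
- b)c. The factor c matters because a - b by itself need not be small. -/
theorem norm_exp_sub_exp_mul_le {𝔸 : Type*} [NormedRing 𝔸] [NormedAlgebra ℝ 𝔸] [CompleteSpace 𝔸]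
    {a b : 𝔸} (hab : Commute a b) (ha : ∀ s : ℝ, 0 ≤ s → ‖exp (s • a)‖ ≤ 1)
    (hb : ∀ s : ℝ, 0 ≤ s → ‖exp (s • b)‖ ≤ 1) (c : 𝔸) :
    ‖(exp a - exp b) * c‖ ≤ ‖(a - b) * c‖ := by
  let _ : NormedAlgebra ℚ 𝔸 := .restrictScalars ℚ ℝ 𝔸
  have hd : ∀ s : ℝ, HasDerivAt (fun s : ℝ => exp (s • a) * exp ((1 - s) • b) * c)
      (exp (s • a) * exp ((1 - s) • b) * ((a - b) * c)) s := fun s => by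
    have h1 := hasDerivAt_exp_smul_const a s
    have h2 := (hasDerivAt_exp_smul_const b (1 - s)).comp_const_sub 1 s
    convert! (h1.mul h2).mul_const c using 1
    have h3 : Commute a (exp ((1 - s) • b)) := (hab.smul_right (1 - s)).exp_right
    have h4 : Commute b (exp ((1 - s) • b)) := ((Commute.refl b).smul_right (1 - s)).exp_right
    simp only [mul_assoc, sub_mul, mul_sub, add_mul, neg_mul, mul_neg]
    rw [← mul_assoc a (exp _) c, h3.eq, mul_assoc, sub_eq_add_neg]
  have h := norm_image_sub_le_of_norm_deriv_le_segment_01'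
    (f := fun s : ℝ => exp (s • a) * exp ((1 - s) • b) * c) (C := ‖(a - b) * c‖)
    (fun s _ => (hd s).hasDerivWithinAt) (fun s hs => by
      refine (norm_mul_le _ _).trans (mul_le_of_le_one_left (norm_nonneg _) ?_)
      refine (norm_mul_le _ _).trans (mul_le_one₀ (ha s hs.1) (norm_nonneg _) (hb _ ?_))
      linarith [hs.2])
  simpa [sub_mul, exp_zero] using h

variable {X : Type*} [NormedAddCommGroup X] [InnerProductSpace ℂ X] [CompleteSpace X]

theorem norm_exp_le_one_of_dissipative {a : X →L[ℂ] X} (ha : ∀ x, (⟪x, a x⟫_ℂ).re ≤ 0) :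
    ‖exp a‖ ≤ 1 := by
  refine ContinuousLinearMap.opNorm_le_bound _ zero_le_one fun x => ?_
  have h1 : ∀ t : ℝ, HasDerivAt (fun t : ℝ => exp (t • a) x) (a (exp (t • a) x)) t := fun t =>
    ((ContinuousLinearMap.apply ℂ X x).restrictScalars ℝ).hasFDerivAt.comp_hasDerivAt t
      (hasDerivAt_exp_smul_const' a t)
  have h2 : ∀ t : ℝ, HasDerivAt (fun t : ℝ => ‖exp (t • a) x‖ ^ 2)
      (2 * (⟪exp (t • a) x, a (exp (t • a) x)⟫_ℂ).re) t := fun t => by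
    have h3 := ((h1 t).inner ℂ (h1 t))
    have h4 := Complex.reCLM.hasFDerivAt.comp_hasDerivAt t h3
    convert! h4 using 1
    · ext s
      simp only [Function.comp, Complex.reCLM_apply]
      rw [inner_self_eq_norm_sq_to_K]
      norm_cast
    · rw [Complex.reCLM_apply, Complex.add_re, two_mul]
      congr 1
      exact inner_re_symm (𝕜 := ℂ) _ _
  have h3 : Antitone (fun t : ℝ => ‖exp (t • a) x‖ ^ 2) :=
    antitone_of_deriv_nonpos (fun t => (h2 t).differentiableAt) fun t => by
      rw [(h2 t).deriv]
      linarith [ha (exp (t • a) x)]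
  have h4 := h3 zero_le_one
  simp only [one_smul, zero_smul, exp_zero, one_apply_eq_self] at h4
  rw [one_mul]
  exact le_of_sq_le_sq h4 (norm_nonneg _)

end Exponentials

/-! ### Yosida approximation of the inverse of a sectorial bounded operator. -/

section Yosida

open NormedSpace Filter

variable {X : Type*} [NormedAddCommGroup X] [InnerProductSpace ℂ X]

/-- The numerical range of `Q` lies in a sector around the negative half axis. -/
def IsNegSectorial (Q : X →L[ℂ] X) (κ : ℝ) : Prop :=
  ∀ y, |(⟪y, Q y⟫_ℂ).im| ≤ κ * -(⟪y, Q y⟫_ℂ).re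

/-- The open convex cone `κ |Im z| < Re z`. -/
def cone (κ : ℝ) : Set ℂ := {z | κ * |z.im| < z.re}

theorem isOpen_cone (κ : ℝ) : IsOpen (cone κ) :=
  isOpen_lt (by fun_prop) (by fun_prop)

theorem smul_mem_cone {κ : ℝ} {z : ℂ} (hz : z ∈ cone κ) {s : ℝ} (hs : 0 < s) :
    (s : ℂ) * z ∈ cone κ := by
  have h : κ * |z.im| < z.re := hz
  simp only [cone, Set.mem_ofPred_eq, Complex.im_ofReal_mul, Complex.re_ofReal_mul, abs_mul,
    abs_of_pos hs]
  nlinarith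

theorem add_mem_cone {κ : ℝ} (hκ : 0 < κ) {z w : ℂ} (hz : z ∈ cone κ) (hw : w ∈ cone κ) :
    z + w ∈ cone κ := by
  have h1 : κ * |z.im| < z.re := hz
  have h2 : κ * |w.im| < w.re := hw
  have h3 := mul_le_mul_of_nonneg_left (abs_add_le z.im w.im) hκ.le
  simp only [cone, Set.mem_ofPred_eq, Complex.add_im, Complex.add_re]
  linarith

theorem ofReal_mem_cone {κ : ℝ} {t : ℝ} (ht : 0 < t) : (t : ℂ) ∈ cone κ := by
  simpa [cone] using ht

/-- For small `ε > 0` this is the Yosida approximation `(Q - ε)⁻¹` of the inverse of `Q`. -/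
noncomputable def yosida (Q : X →L[ℂ] X) (ε : ℝ) : X →L[ℂ] X :=
  Ring.inverse (Q - (ε : ℂ) • 1)

variable {Q : X →L[ℂ] X} {κ : ℝ}

theorem IsNegSectorial.re_nonpos (hQ : IsNegSectorial Q κ) (hκ : 0 < κ) (y : X) :
    (⟪y, Q y⟫_ℂ).re ≤ 0 := by
  have := (abs_nonneg _).trans (hQ y)
  linarith [nonneg_of_mul_nonneg_right this hκ]

variable [CompleteSpace X]

theorem IsNegSectorial.isUnit_sub (hQ : IsNegSectorial Q κ) (hκ : 0 < κ) {ε : ℝ} (hε : 0 < ε) :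
    IsUnit (Q - (ε : ℂ) • 1) := by
  refine ContinuousLinearMap.isUnit_of_forall_le_norm_inner_map _ (c := ⟨ε, hε.le⟩) hε fun x => ?_
  have h1 := Complex.abs_re_le_norm ⟪(Q - (ε : ℂ) • 1) x, x⟫_ℂ
  have h2 : (⟪(Q - (ε : ℂ) • 1) x, x⟫_ℂ).re = (⟪x, Q x⟫_ℂ).re - ε * ‖x‖ ^ 2 := by
    simp only [sub_apply, smul_apply,
      one_apply_eq_self, inner_sub_left, inner_smul_left, Complex.sub_re,
      Complex.conj_ofReal, Complex.re_ofReal_mul]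
    congr 1
    · exact inner_re_symm (𝕜 := ℂ) _ _
    · congr 1
      exact (norm_sq_eq_re_inner (𝕜 := ℂ) x).symm
  rw [h2, abs_of_nonpos (by nlinarith [hQ.re_nonpos hκ x, sq_nonneg ‖x‖])] at h1
  refine le_trans ?_ h1
  show ‖x‖ ^ 2 * ε ≤ _
  linarith [hQ.re_nonpos hκ x]

theorem IsNegSectorial.mul_yosida (hQ : IsNegSectorial Q κ) (hκ : 0 < κ) {ε : ℝ} (hε : 0 < ε) :
    Q * yosida Q ε = 1 + (ε : ℂ) • yosida Q ε := by
  have h := Ring.mul_inverse_cancel _ (hQ.isUnit_sub hκ hε)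
  rw [sub_mul, smul_mul_assoc, one_mul, sub_eq_iff_eq_add] at h
  exact h

theorem IsNegSectorial.yosida_mul (hQ : IsNegSectorial Q κ) (hκ : 0 < κ) {ε : ℝ} (hε : 0 < ε) :
    yosida Q ε * Q = 1 + (ε : ℂ) • yosida Q ε := by
  have h := Ring.inverse_mul_cancel _ (hQ.isUnit_sub hκ hε)
  rw [mul_sub, mul_smul_comm, mul_one, sub_eq_iff_eq_add] at h
  exact h

theorem IsNegSectorial.commute_yosida (hQ : IsNegSectorial Q κ) (hκ : 0 < κ) {ε : ℝ} (hε : 0 < ε)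
    {B : X →L[ℂ] X} (hB : Commute Q B) : Commute (yosida Q ε) B := by
  have h1 : Commute (Q - (ε : ℂ) • 1) B := hB.sub_left ((Commute.one_left B).smul_left _)
  obtain ⟨u, hu⟩ := hQ.isUnit_sub hκ hε
  rw [yosida, ← hu, Ring.inverse_unit]
  rw [← hu] at h1
  exact h1.units_inv_left

theorem IsNegSectorial.apply_yosida (hQ : IsNegSectorial Q κ) (hκ : 0 < κ) {ε : ℝ} (hε : 0 < ε)
    (x : X) : Q (yosida Q ε x) - (ε : ℂ) • yosida Q ε x = x := by
  have h := congrArg (fun B : X →L[ℂ] X => B x) (hQ.mul_yosida hκ hε)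
  simp only [add_apply, one_apply_eq_self, smul_apply] at h
  have h' : (Q * yosida Q ε) x = Q (yosida Q ε x) := rfl
  rw [← h', h, add_sub_cancel_right]

theorem IsNegSectorial.norm_yosida_le (hQ : IsNegSectorial Q κ) (hκ : 0 < κ) {ε : ℝ} (hε : 0 < ε) :
    ε * ‖yosida Q ε‖ ≤ 1 := by
  rw [← le_div_iff₀' hε]
  refine ContinuousLinearMap.opNorm_le_bound _ (by positivity) fun x => ?_
  obtain ⟨w, hw⟩ : ∃ w, w = yosida Q ε x := ⟨_, rfl⟩
  have h := hQ.apply_yosida hκ hε x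
  rw [← hw] at h ⊢
  rw [one_div_mul_eq_div, le_div_iff₀ hε]
  have h1 : (⟪w, x⟫_ℂ).re = (⟪w, Q w⟫_ℂ).re - ε * ‖w‖ ^ 2 := by
    rw [← h, inner_sub_right, inner_smul_right, Complex.sub_re, Complex.re_ofReal_mul]
    congr 2
    exact (norm_sq_eq_re_inner (𝕜 := ℂ) w).symm
  have h2 := (Complex.abs_re_le_norm _).trans (norm_inner_le_norm (𝕜 := ℂ) w x)
  have h3 := neg_abs_le (⟪w, x⟫_ℂ).re
  rcases eq_or_ne w 0 with h0 | h0
  · simp [h0]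
  · refine le_of_mul_le_mul_left ?_ (norm_pos_iff.mpr h0)
    linarith [hQ.re_nonpos hκ w]

/-- With w = (Q - ε)⁻¹x the form becomes one in ⟪w, Qw⟫ and ‖w‖². The sector condition on Q absorbs
the contribution of Im z exactly when z lies in the closed cone. -/
theorem IsNegSectorial.re_inner_smul_yosida_nonpos (hQ : IsNegSectorial Q κ) (hκ : 0 < κ) {ε : ℝ}
    (hε : 0 < ε) {z : ℂ} (hz : κ * |z.im| ≤ z.re) (x : X) :
    (⟪x, (z • yosida Q ε) x⟫_ℂ).re ≤ 0 := by
  obtain ⟨w, hw⟩ : ∃ w, w = yosida Q ε x := ⟨_, rfl⟩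
  have h := hQ.apply_yosida hκ hε x
  rw [smul_apply, ← hw]
  rw [← hw] at h
  have hm := hQ.re_nonpos hκ w
  have hs := hQ w
  have h1 : (⟪x, z • w⟫_ℂ).re = z.re * (⟪w, Q w⟫_ℂ).re + z.im * (⟪w, Q w⟫_ℂ).im
      - ε * z.re * ‖w‖ ^ 2 := by
    rw [← h, inner_smul_right, inner_sub_left, inner_smul_left, inner_self_eq_norm_sq_to_K]
    have e1 : (⟪Q w, w⟫_ℂ).re = (⟪w, Q w⟫_ℂ).re := inner_re_symm (𝕜 := ℂ) _ _
    have e2 : (⟪Q w, w⟫_ℂ).im = -(⟪w, Q w⟫_ℂ).im := inner_im_symm (𝕜 := ℂ) _ _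
    simp [Complex.mul_re, sq, ← Complex.ofReal_mul, e1, e2]
    ring
  rw [h1]
  have h2 : z.im * (⟪w, Q w⟫_ℂ).im ≤ |z.im| * (κ * -(⟪w, Q w⟫_ℂ).re) := by
    refine (le_abs_self _).trans ?_
    rw [abs_mul]
    exact mul_le_mul_of_nonneg_left hs (abs_nonneg _)
  have h3 : 0 ≤ z.re := le_trans (by positivity) hz
  have h4 : 0 ≤ ε * z.re * ‖w‖ ^ 2 := by positivity
  have h5 := mul_le_mul_of_nonneg_right hz (neg_nonneg.mpr hm)
  linarith

theorem IsNegSectorial.norm_exp_yosida_le (hQ : IsNegSectorial Q κ) (hκ : 0 < κ) {ε : ℝ}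
    (hε : 0 < ε) {z : ℂ} (hz : κ * |z.im| ≤ z.re) : ‖exp (z • yosida Q ε)‖ ≤ 1 :=
  norm_exp_le_one_of_dissipative (hQ.re_inner_smul_yosida_nonpos hκ hε hz)

/-- Cauchy's estimate for the derivative of a function bounded by 1 on the disc. The bound does not
depend on ε although the norms of the Yosida operators may blow up. -/
theorem IsNegSectorial.norm_yosida_mul_exp_le (hQ : IsNegSectorial Q κ) (hκ : 0 < κ) {ε : ℝ}
    (hε : 0 < ε) {z : ℂ} {ρ : ℝ} (hρ : 0 < ρ) (hz : Metric.closedBall z ρ ⊆ cone κ) :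
    ‖yosida Q ε * exp (z • yosida Q ε)‖ ≤ 1 / ρ := by
  rw [← (hasDerivAt_exp_smul_const' (yosida Q ε) z).deriv]
  refine Complex.norm_deriv_le_of_forall_mem_sphere_norm_le hρ
    (differentiable_exp_smul_const ℂ (yosida Q ε)).diffContOnCl fun w hw => ?_
  exact hQ.norm_exp_yosida_le hκ hε (hz (Metric.sphere_subset_closedBall hw)).le

theorem IsNegSectorial.yosida_sub_yosida (hQ : IsNegSectorial Q κ) (hκ : 0 < κ) {ε η : ℝ}
    (hε : 0 < ε) (hη : 0 < η) :
    yosida Q ε - yosida Q η = ((ε : ℂ) - η) • (yosida Q ε * yosida Q η) := by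
  have h1 : yosida Q ε * Q * yosida Q η = yosida Q ε * (Q * yosida Q η) := mul_assoc _ _ _
  rw [hQ.yosida_mul hκ hε, hQ.mul_yosida hκ hη, add_mul, mul_add, one_mul, mul_one,
    smul_mul_assoc, mul_smul_comm] at h1
  rw [sub_smul]
  exact (sub_eq_sub_iff_add_eq_add.mpr (by rw [← h1]; abel))

theorem norm_one_add_smul_yosida_le (hQ : IsNegSectorial Q κ) (hκ : 0 < κ) {ε : ℝ}
    (hε : 0 < ε) {c : ℂ} (hc : ‖c‖ ≤ ε) : ‖1 + c • yosida Q ε‖ ≤ 2 := by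
  have h1 : ‖c • yosida Q ε‖ ≤ 1 := by
    rw [norm_smul]
    exact (mul_le_mul_of_nonneg_right hc (norm_nonneg _)).trans (hQ.norm_yosida_le hκ hε)
  have h2 : ‖(1 : X →L[ℂ] X)‖ ≤ 1 := ContinuousLinearMap.norm_id_le
  linarith [norm_add_le 1 (c • yosida Q ε)]

/-- Write Y for the Yosida operators. The resolvent identity replaces Y_ε Y_η by Y_ε² up to a factor
of norm at most 2. Each of the two factors Y_ε is then absorbed by its own copy of exp((z/4)Y_ε). -/
theorem IsNegSectorial.norm_yosida_mul_mul_exp_le (hQ : IsNegSectorial Q κ) (hκ : 0 < κ) {ε η : ℝ}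
    (hε : 0 < ε) (hη : 0 < η) (hεη : |ε - η| ≤ η) {z : ℂ} {ρ : ℝ} (hρ : 0 < ρ)
    (hz : Metric.closedBall (z / 4) ρ ⊆ cone κ) :
    ‖yosida Q ε * yosida Q η * exp ((z / 2) • yosida Q ε)‖ ≤ 2 * (1 / ρ) ^ 2 := by
  let _ : NormedAlgebra ℚ (X →L[ℂ] X) := .restrictScalars ℚ ℂ _
  have hc : Commute (yosida Q ε) (exp ((z / 4) • yosida Q ε)) :=
    ((Commute.refl _).smul_right _).exp_right
  have h1 : yosida Q ε * yosida Q η = (1 + ((η : ℂ) - ε) • yosida Q η) * (yosida Q ε * yosida Q ε)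
      := by
    have h2 := hQ.yosida_sub_yosida hκ hη hε
    rw [add_mul, one_mul, smul_mul_assoc, ← mul_assoc, ← smul_mul_assoc, ← h2, sub_mul,
      add_sub_cancel]
    exact (hQ.commute_yosida hκ hε (hQ.commute_yosida hκ hη (Commute.refl Q)).symm).eq
  have h2 : exp ((z / 2) • yosida Q ε) =
      exp ((z / 4) • yosida Q ε) * exp ((z / 4) • yosida Q ε) := by
    rw [← exp_add_of_commute (Commute.refl _), ← add_smul]
    congr 2
    ring
  have h3 : yosida Q ε * yosida Q η * exp ((z / 2) • yosida Q ε) =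
      (1 + ((η : ℂ) - ε) • yosida Q η) * ((yosida Q ε * exp ((z / 4) • yosida Q ε)) *
        (yosida Q ε * exp ((z / 4) • yosida Q ε))) := by
    rw [h1, h2, mul_assoc, mul_assoc]
    congr 1
    rw [mul_assoc]
    congr 1
    rw [← mul_assoc, ← mul_assoc, hc.eq]
  have h4 := hQ.norm_yosida_mul_exp_le hκ hε hρ hz
  rw [h3]
  refine (norm_mul_le _ _).trans (mul_le_mul (norm_one_add_smul_yosida_le hQ hκ hη ?_) ?_
    (norm_nonneg _) zero_le_two)
  · rw [← Complex.ofReal_sub, Complex.norm_real, Real.norm_eq_abs, abs_sub_comm]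
    exact hεη
  · rw [sq]
    exact (norm_mul_le _ _).trans (mul_le_mul h4 h4 (norm_nonneg _) (by positivity))

/-- The difference factors as (eᵃ - eᵇ)(eᵃ + eᵇ) with half exponents a, b. One half serves the
interpolation estimate, and the other smooths the product Y_ε Y_η that the resolvent identity
produces from a - b. -/
theorem IsNegSectorial.norm_exp_yosida_sub_le (hQ : IsNegSectorial Q κ) (hκ : 0 < κ) {ε η : ℝ}
    (hε : 0 < ε) (hη : 0 < η) (hεη : |ε - η| ≤ η) (hηε : |ε - η| ≤ ε) {z : ℂ} {ρ : ℝ} (hρ : 0 < ρ)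
    (hz : Metric.closedBall (z / 4) ρ ⊆ cone κ) :
    ‖exp (z • yosida Q ε) - exp (z • yosida Q η)‖ ≤ 2 * ‖z‖ * (1 / ρ) ^ 2 * |ε - η| := by
  let _ : NormedAlgebra ℚ (X →L[ℂ] X) := .restrictScalars ℚ ℂ _
  have hz4 : z / 4 ∈ cone κ := hz (Metric.mem_closedBall_self hρ.le)
  have hz2 : ∀ s : ℝ, 0 ≤ s → κ * |((s : ℂ) * (z / 2)).im| ≤ ((s : ℂ) * (z / 2)).re := by
    intro s hs
    rcases hs.eq_or_lt with rfl | hs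
    · simp
    · have h1 : κ * |(((s * 2 : ℝ) : ℂ) * (z / 4)).im| < (((s * 2 : ℝ) : ℂ) * (z / 4)).re :=
        smul_mem_cone hz4 (show 0 < s * 2 by positivity)
      have h2 : (s : ℂ) * (z / 2) = ((s * 2 : ℝ) : ℂ) * (z / 4) := by push_cast; ring
      rw [h2]
      exact h1.le
  have hcon : ∀ ε' : ℝ, 0 < ε' → ∀ s : ℝ, 0 ≤ s → ‖exp (s • ((z / 2) • yosida Q ε'))‖ ≤ 1 := by
    intro ε' hε' s hs
    have h1 : s • ((z / 2) • yosida Q ε') = ((s : ℂ) * (z / 2)) • yosida Q ε' := by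
      rw [mul_smul]; rfl
    rw [h1]
    exact hQ.norm_exp_yosida_le hκ hε' (hz2 s hs)
  have hcomm : Commute (yosida Q ε) (yosida Q η) :=
    hQ.commute_yosida hκ hε (hQ.commute_yosida hκ hη (Commute.refl Q)).symm
  set a := (z / 2) • yosida Q ε with ha
  set b := (z / 2) • yosida Q η with hb
  have hab : Commute a b := (hcomm.smul_left _).smul_right _
  have hdbl : ∀ ε' : ℝ, exp (z • yosida Q ε') =
      exp ((z / 2) • yosida Q ε') * exp ((z / 2) • yosida Q ε') := by
    intro ε'
    rw [← exp_add_of_commute (Commute.refl _), ← add_smul, add_halves]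
  have hsplit : exp (z • yosida Q ε) - exp (z • yosida Q η) =
      (exp a - exp b) * exp a + (exp a - exp b) * exp b := by
    have h1 : exp a * exp b = exp b * exp a := hab.exp.eq
    rw [hdbl, hdbl, ← ha, ← hb, sub_mul, sub_mul, h1]
    abel
  have hsub : a - b = (z / 2 * ((ε : ℂ) - η)) • (yosida Q ε * yosida Q η) := by
    rw [ha, hb, ← smul_sub, hQ.yosida_sub_yosida hκ hε hη, smul_smul]
  have hn : ‖z / 2 * ((ε : ℂ) - η)‖ = ‖z‖ / 2 * |ε - η| := by
    rw [norm_mul, norm_div, ← Complex.ofReal_sub, Complex.norm_real, Real.norm_eq_abs]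
    simp
  have e1 : ‖(a - b) * exp a‖ ≤ ‖z‖ / 2 * |ε - η| * (2 * (1 / ρ) ^ 2) := by
    rw [hsub, smul_mul_assoc, norm_smul, hn]
    exact mul_le_mul_of_nonneg_left (hQ.norm_yosida_mul_mul_exp_le hκ hε hη hεη hρ hz)
      (by positivity)
  have e2 : ‖(a - b) * exp b‖ ≤ ‖z‖ / 2 * |ε - η| * (2 * (1 / ρ) ^ 2) := by
    rw [hsub, smul_mul_assoc, norm_smul, hn, hcomm.eq]
    exact mul_le_mul_of_nonneg_left (hQ.norm_yosida_mul_mul_exp_le hκ hη hε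
      (by rwa [abs_sub_comm]) hρ hz) (by positivity)
  rw [hsplit]
  have h1 := norm_exp_sub_exp_mul_le hab (hcon ε hε) (hcon η hη) (exp a)
  have h2 := norm_exp_sub_exp_mul_le hab (hcon ε hε) (hcon η hη) (exp b)
  refine (norm_add_le _ _).trans ?_
  linarith

end Yosida

/-! ### The analytic semigroup generated by Q⁻¹. -/

section SectorialSemigroup

open NormedSpace Filter

variable {X : Type*} [NormedAddCommGroup X] [InnerProductSpace ℂ X]

/-- The exponentials of the Yosida approximations of the inverse of `Q`. -/
noncomputable def expApprox (Q : X →L[ℂ] X) (n : ℕ) (z : ℂ) : X →L[ℂ] X :=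
  exp (z • yosida Q ((1 / 2) ^ n))

/-- The semigroup generated by the inverse of `Q`. -/
noncomputable def expInverse (Q : X →L[ℂ] X) (z : ℂ) : X →L[ℂ] X :=
  limUnder atTop fun n => expApprox Q n z

theorem expApprox_zero (Q : X →L[ℂ] X) (n : ℕ) : expApprox Q n 0 = 1 := by
  rw [expApprox, zero_smul, exp_zero]

/-- The point 0 is outside the open cone, so the convergence theorem does not cover it. -/
theorem expInverse_zero (Q : X →L[ℂ] X) : expInverse Q 0 = 1 := by
  refine Tendsto.limUnder_eq ?_
  simp only [expApprox_zero]
  exact tendsto_const_nhds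

variable [CompleteSpace X] {Q : X →L[ℂ] X} {κ : ℝ}

/-- A single radius ρ serves all w near z, which makes the Cauchy estimates locally uniform. -/
theorem exists_closedBall_subset_cone {z : ℂ} (hz : z ∈ cone κ) :
    ∃ ρ : ℝ, 0 < ρ ∧ ∀ w ∈ Metric.ball z (4 * ρ), Metric.closedBall (w / 4) ρ ⊆ cone κ := by
  have h4 : z / 4 ∈ cone κ := by
    have := smul_mem_cone hz (show (0 : ℝ) < 1 / 4 by norm_num)
    convert! this using 1
    push_cast
    ring
  obtain ⟨ε, hε, hb⟩ := Metric.isOpen_iff.mp (isOpen_cone κ) _ h4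
  refine ⟨ε / 3, by positivity, fun w hw v hv => hb ?_⟩
  rw [Metric.mem_ball, dist_eq_norm] at hw ⊢
  rw [Metric.mem_closedBall, dist_eq_norm] at hv
  have h1 : v - z / 4 = (v - w / 4) + (w - z) / 4 := by ring
  have h2 : ‖(w - z) / 4‖ = ‖w - z‖ / 4 := by simp
  rw [h1]
  refine (norm_add_le _ _).trans_lt ?_
  linarith

namespace IsNegSectorial

theorem dist_expApprox_succ_le (hQ : IsNegSectorial Q κ) (hκ : 0 < κ) {z : ℂ} {ρ : ℝ} (hρ : 0 < ρ)
    (hz : Metric.closedBall (z / 4) ρ ⊆ cone κ) (n : ℕ) :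
    dist (expApprox Q n z) (expApprox Q (n + 1) z) ≤ ‖z‖ * (1 / ρ) ^ 2 * (1 / 2) ^ n := by
  have hp : (0 : ℝ) < (1 / 2) ^ n := by positivity
  have h1 : |(1 / 2 : ℝ) ^ n - (1 / 2) ^ (n + 1)| = (1 / 2) ^ n / 2 := by
    rw [abs_of_nonneg (by rw [pow_succ]; linarith), pow_succ]
    ring
  rw [dist_eq_norm]
  refine (hQ.norm_exp_yosida_sub_le hκ hp (by positivity) ?_ ?_ hρ hz).trans (le_of_eq ?_)
  · rw [h1, pow_succ]
    linarith
  · rw [h1]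
    linarith
  · rw [h1]
    ring

theorem tendsto_expApprox (hQ : IsNegSectorial Q κ) (hκ : 0 < κ) {z : ℂ} (hz : z ∈ cone κ) :
    Tendsto (fun n => expApprox Q n z) atTop (𝓝 (expInverse Q z)) := by
  obtain ⟨ρ, hρ, h⟩ := exists_closedBall_subset_cone hz
  exact (cauchySeq_of_le_geometric _ _ (by norm_num) (hQ.dist_expApprox_succ_le hκ hρ
    (h z (Metric.mem_ball_self (by positivity))))).tendsto_limUnder

theorem tendstoLocallyUniformlyOn_expApprox (hQ : IsNegSectorial Q κ) (hκ : 0 < κ) :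
    TendstoLocallyUniformlyOn (expApprox Q) (expInverse Q) atTop (cone κ) := by
  rw [Metric.tendstoLocallyUniformlyOn_iff]
  intro ε hε z hz
  obtain ⟨ρ, hρ, h⟩ := exists_closedBall_subset_cone hz
  refine ⟨cone κ ∩ Metric.ball z (4 * ρ), inter_mem self_mem_nhdsWithin
    (mem_nhdsWithin_of_mem_nhds (Metric.ball_mem_nhds _ (by positivity))), ?_⟩
  have h1 : Tendsto (fun n : ℕ => (‖z‖ + 4 * ρ) * (1 / ρ) ^ 2 * (1 / 2 : ℝ) ^ n / (1 - 1 / 2))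
      atTop (𝓝 ((‖z‖ + 4 * ρ) * (1 / ρ) ^ 2 * 0 / (1 - 1 / 2))) :=
    ((tendsto_pow_atTop_nhds_zero_of_lt_one (by norm_num) (by norm_num)).const_mul _).div_const _
  rw [mul_zero, zero_div] at h1
  filter_upwards [h1.eventually_lt_const hε] with n hn w hw
  rw [dist_comm]
  refine lt_of_le_of_lt ((dist_le_of_le_geometric_of_tendsto _ _ (by norm_num)
    (hQ.dist_expApprox_succ_le hκ hρ (h w hw.2)) (hQ.tendsto_expApprox hκ hw.1) n).trans ?_) hn
  have h2 : ‖w‖ ≤ ‖z‖ + 4 * ρ := by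
    have h3 := hw.2
    rw [Metric.mem_ball, dist_eq_norm] at h3
    linarith [norm_sub_norm_le w z]
  gcongr

theorem differentiable_expApprox (Q : X →L[ℂ] X) (n : ℕ) : Differentiable ℂ (expApprox Q n) :=
  differentiable_exp_smul_const ℂ _

theorem differentiableOn_expInverse (hQ : IsNegSectorial Q κ) (hκ : 0 < κ) :
    DifferentiableOn ℂ (expInverse Q) (cone κ) :=
  (hQ.tendstoLocallyUniformlyOn_expApprox hκ).differentiableOn
    (Eventually.of_forall fun n => (differentiable_expApprox Q n).differentiableOn)
    (isOpen_cone κ)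

theorem norm_expApprox_le (hQ : IsNegSectorial Q κ) (hκ : 0 < κ) {z : ℂ} (hz : z ∈ cone κ) (n : ℕ) :
    ‖expApprox Q n z‖ ≤ 1 :=
  hQ.norm_exp_yosida_le hκ (by positivity) (le_of_lt hz)

theorem norm_expInverse_le (hQ : IsNegSectorial Q κ) (hκ : 0 < κ) {z : ℂ} (hz : z ∈ cone κ) :
    ‖expInverse Q z‖ ≤ 1 :=
  le_of_tendsto (hQ.tendsto_expApprox hκ hz).norm
    (Eventually.of_forall (hQ.norm_expApprox_le hκ hz))

theorem expInverse_add (hQ : IsNegSectorial Q κ) (hκ : 0 < κ) {z w : ℂ} (hz : z ∈ cone κ)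
    (hw : w ∈ cone κ) : expInverse Q (z + w) = expInverse Q z * expInverse Q w := by
  let _ : NormedAlgebra ℚ (X →L[ℂ] X) := .restrictScalars ℚ ℂ _
  refine tendsto_nhds_unique (hQ.tendsto_expApprox hκ (add_mem_cone hκ hz hw)) ?_
  refine ((hQ.tendsto_expApprox hκ hz).mul (hQ.tendsto_expApprox hκ hw)).congr fun n => ?_
  rw [expApprox, expApprox, expApprox, add_smul, exp_add_of_commute]
  exact ((Commute.refl _).smul_left _).smul_right _

theorem commute_expApprox (hQ : IsNegSectorial Q κ) (hκ : 0 < κ) {B : X →L[ℂ] X}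
    (hB : Commute Q B) (n : ℕ) (z : ℂ) : Commute (expApprox Q n z) B :=
  ((hQ.commute_yosida hκ (by positivity) hB).smul_left z).exp_left

theorem commute_expInverse (hQ : IsNegSectorial Q κ) (hκ : 0 < κ) {B : X →L[ℂ] X}
    (hB : Commute Q B) {z : ℂ} (hz : z ∈ cone κ) : Commute (expInverse Q z) B := by
  have h := hQ.tendsto_expApprox hκ hz
  exact tendsto_nhds_unique (h.mul_const B)
    ((h.const_mul B).congr fun n => (hQ.commute_expApprox hκ hB n z).symm.eq)

/-- Derivatives of the approximants converge too. For them the identity holds up to 2⁻ⁿ times a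
derivative that is bounded uniformly in n. -/
theorem mul_deriv_expInverse (hQ : IsNegSectorial Q κ) (hκ : 0 < κ) {z : ℂ} (hz : z ∈ cone κ) :
    Q * deriv (expInverse Q) z = expInverse Q z := by
  obtain ⟨ρ, hρ, hb⟩ := Metric.nhds_basis_closedBall.mem_iff.mp ((isOpen_cone κ).mem_nhds hz)
  have h1 := ((hQ.tendstoLocallyUniformlyOn_expApprox hκ).deriv
    (Eventually.of_forall fun n => (differentiable_expApprox Q n).differentiableOn)
    (isOpen_cone κ)).tendsto_at hz
  refine tendsto_nhds_unique (h1.const_mul Q) ?_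
  have h2 : Tendsto (fun n : ℕ => (((1 / 2 : ℝ) ^ n : ℝ) : ℂ) •
      (yosida Q ((1 / 2) ^ n) * expApprox Q n z)) atTop (𝓝 0) := by
    rw [tendsto_zero_iff_norm_tendsto_zero]
    have h3 : Tendsto (fun n : ℕ => (1 / 2 : ℝ) ^ n * (1 / ρ)) atTop (𝓝 (0 * (1 / ρ))) :=
      (tendsto_pow_atTop_nhds_zero_of_lt_one (by norm_num) (by norm_num)).mul_const _
    rw [zero_mul] at h3
    refine squeeze_zero (fun n => norm_nonneg _) (fun n => ?_) h3
    have hp : (0 : ℝ) < (1 / 2) ^ n := by positivity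
    rw [norm_smul, Complex.norm_real, Real.norm_of_nonneg hp.le]
    exact mul_le_mul_of_nonneg_left (hQ.norm_yosida_mul_exp_le hκ hp hρ hb) hp.le
  have h3 := (hQ.tendsto_expApprox hκ hz).add h2
  rw [add_zero] at h3
  refine h3.congr fun n => ?_
  have hd : deriv (expApprox Q n) z = yosida Q ((1 / 2) ^ n) * expApprox Q n z :=
    (hasDerivAt_exp_smul_const' (yosida Q ((1 / 2) ^ n)) z).deriv
  show _ = Q * deriv (expApprox Q n) z
  rw [hd, ← mul_assoc, hQ.mul_yosida hκ (by positivity), add_mul, one_mul, smul_mul_assoc]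

theorem hasDerivAt_mul_expInverse (hQ : IsNegSectorial Q κ) (hκ : 0 < κ) {z : ℂ}
    (hz : z ∈ cone κ) : HasDerivAt (fun z => Q * expInverse Q z) (expInverse Q z) z := by
  have h := (((hQ.differentiableOn_expInverse hκ).differentiableAt
    ((isOpen_cone κ).mem_nhds hz)).hasDerivAt).const_mul Q
  rwa [hQ.mul_deriv_expInverse hκ hz] at h

/-- On the range of Q the approximate generators are uniformly bounded: (Q - ε)⁻¹Q = 1 + ε(Q - ε)⁻¹
has norm at most 2. -/
theorem norm_expInverse_apply_sub_le (hQ : IsNegSectorial Q κ) (hκ : 0 < κ) {z : ℂ}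
    (hz : z ∈ cone κ) (y : X) : ‖expInverse Q z (Q y) - Q y‖ ≤ 2 * ‖z‖ * ‖y‖ := by
  have h0 : ‖(1 : X →L[ℂ] X)‖ ≤ 1 := ContinuousLinearMap.norm_id_le
  have hn : ∀ n, ‖(expApprox Q n z - 1) * Q‖ ≤ 2 * ‖z‖ := fun n => by
    have hp : (0 : ℝ) < (1 / 2) ^ n := by positivity
    have h1 := norm_exp_sub_exp_mul_le (a := z • yosida Q ((1 / 2) ^ n)) (b := 0)
      (Commute.zero_right _) (fun s hs => by
        have h2 : s • z • yosida Q ((1 / 2) ^ n) = ((s : ℂ) * z) • yosida Q ((1 / 2) ^ n) := by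
          rw [mul_smul]; rfl
        rw [h2]
        rcases hs.eq_or_lt with rfl | hs
        · simpa using h0
        · exact hQ.norm_expApprox_le hκ (smul_mem_cone hz hs) n)
      (fun s _ => by simpa using h0) Q
    rw [exp_zero, sub_zero, smul_mul_assoc, hQ.yosida_mul hκ hp, norm_smul] at h1
    have h3 := norm_one_add_smul_yosida_le hQ hκ hp (c := (((1 / 2) ^ n : ℝ) : ℂ))
      (by rw [Complex.norm_real, Real.norm_of_nonneg hp.le])
    refine h1.trans ?_
    rw [mul_comm]
    exact mul_le_mul_of_nonneg_right h3 (norm_nonneg _)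
  have h1 : ‖(expInverse Q z - 1) * Q‖ ≤ 2 * ‖z‖ :=
    le_of_tendsto (((hQ.tendsto_expApprox hκ hz).sub_const 1).mul_const Q).norm
      (Eventually.of_forall hn)
  exact (((expInverse Q z - 1) * Q).le_opNorm y).trans
    (mul_le_mul_of_nonneg_right h1 (norm_nonneg y))

/-- If y is orthogonal to the range, the form at y + tx has no constant term, so its linear
coefficient Re ⟪x, Qy⟫ cannot be positive. The choice x = Qy gives Qy = 0. -/
theorem denseRange (hQ : IsNegSectorial Q κ) (hκ : 0 < κ) (hinj : Function.Injective Q) :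
    DenseRange Q := by
  have h : (LinearMap.range (Q : X →ₗ[ℂ] X)).topologicalClosure = ⊤ := by
    rw [Submodule.topologicalClosure_eq_top_iff, Submodule.eq_bot_iff]
    intro y hy
    have hy' : ∀ x, ⟪y, Q x⟫_ℂ = 0 := fun x => (Submodule.mem_orthogonal' _ _).mp hy _ ⟨x, rfl⟩
    refine (injective_iff_map_eq_zero Q).mp hinj y ?_
    rw [← inner_self_eq_zero (𝕜 := ℂ)]
    have h1 : ∀ x, ∀ t : ℝ, t * (⟪x, Q y⟫_ℂ).re + t ^ 2 * (⟪x, Q x⟫_ℂ).re ≤ 0 := fun x t => by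
      have h2 := hQ.re_nonpos hκ (y + (t : ℂ) • x)
      rw [map_add, map_smul, inner_add_left, inner_add_right, inner_add_right, inner_smul_right,
        inner_smul_left, inner_smul_left, inner_smul_right, hy', hy'] at h2
      simp only [Complex.add_re, Complex.conj_ofReal, Complex.re_ofReal_mul, mul_zero,
        Complex.zero_re] at h2
      linarith
    have h2 : (⟪Q y, Q y⟫_ℂ).re ≤ 0 := by
      by_contra hc
      push Not at hc
      obtain ⟨m, hm⟩ : ∃ m, m = -(⟪Q y, Q (Q y)⟫_ℂ).re := ⟨_, rfl⟩
      have hm0 : 0 ≤ m := by rw [hm]; linarith [hQ.re_nonpos hκ (Q y)]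
      obtain ⟨p, hp⟩ : ∃ p, p = (⟪Q y, Q y⟫_ℂ).re := ⟨_, rfl⟩
      have h3 := h1 (Q y) (p / (m + 1))
      rw [← hp] at h3 hc
      have h4 : (⟪Q y, Q (Q y)⟫_ℂ).re = -m := by linarith
      rw [h4] at h3
      have h5 : p / (m + 1) * p + (p / (m + 1)) ^ 2 * -m = (p / (m + 1)) ^ 2 := by
        field_simp
        ring
      rw [h5] at h3
      have : 0 < (p / (m + 1)) ^ 2 := by positivity
      linarith
    have h3 : (⟪Q y, Q y⟫_ℂ).re = ‖Q y‖ ^ 2 := (norm_sq_eq_re_inner (𝕜 := ℂ) _).symm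
    rw [h3] at h2
    rw [inner_self_eq_zero, ← norm_eq_zero]
    exact pow_eq_zero_iff two_ne_zero |>.mp (le_antisymm h2 (sq_nonneg _))
  exact (Submodule.dense_iff_topologicalClosure_eq_top).mpr h

theorem tendsto_expInverse_apply (hQ : IsNegSectorial Q κ) (hκ : 0 < κ)
    (hinj : Function.Injective Q) (x : X) :
    Tendsto (fun z => expInverse Q z x) (𝓝[cone κ] 0) (𝓝 x) := by
  rw [Metric.tendsto_nhds]
  intro ε hε
  obtain ⟨y, hy⟩ := Metric.denseRange_iff.mp (hQ.denseRange hκ hinj) x (ε / 3) (by positivity)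
  have h1 : Tendsto (fun z : ℂ => 2 * ‖z‖ * ‖y‖) (𝓝[cone κ] 0) (𝓝 (2 * ‖(0 : ℂ)‖ * ‖y‖)) :=
    tendsto_nhdsWithin_of_tendsto_nhds (Continuous.tendsto (by fun_prop) 0)
  rw [norm_zero, mul_zero, zero_mul] at h1
  filter_upwards [h1.eventually_lt_const (show 0 < ε / 3 by positivity), self_mem_nhdsWithin]
    with z hz hzc
  have h2 := hQ.norm_expInverse_apply_sub_le hκ hzc y
  have h3 : ‖expInverse Q z (x - Q y)‖ ≤ ‖x - Q y‖ :=
    ((expInverse Q z).le_opNorm _).trans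
      (mul_le_of_le_one_left (norm_nonneg _) (hQ.norm_expInverse_le hκ hzc))
  rw [dist_eq_norm] at hy ⊢
  have h4 : expInverse Q z x - x =
      expInverse Q z (x - Q y) + (expInverse Q z (Q y) - Q y) - (x - Q y) := by
    rw [map_sub]
    abel
  rw [h4]
  have h5 := norm_sub_le (expInverse Q z (x - Q y) + (expInverse Q z (Q y) - Q y)) (x - Q y)
  have h6 := norm_add_le (expInverse Q z (x - Q y)) (expInverse Q z (Q y) - Q y)
  linarith

theorem tendsto_ofReal_nhdsGT : Tendsto (fun t : ℝ => (t : ℂ)) (𝓝[>] 0) (𝓝[cone κ] 0) := by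
  refine tendsto_nhdsWithin_iff.mpr ⟨?_, ?_⟩
  · exact tendsto_nhdsWithin_of_tendsto_nhds (Complex.continuous_ofReal.tendsto' 0 0 (by simp))
  · filter_upwards [self_mem_nhdsWithin] with t ht
    exact ofReal_mem_cone ht

theorem continuousOn_expInverse_apply (hQ : IsNegSectorial Q κ) (hκ : 0 < κ)
    (hinj : Function.Injective Q) (x : X) :
    ContinuousOn (fun t : ℝ => expInverse Q t x) (Set.Ici 0) := by
  intro t ht
  rcases (Set.mem_Ici.mp ht).eq_or_lt with rfl | ht
  · rw [← Set.Ioi_insert, continuousWithinAt_insert_self, ContinuousWithinAt,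
      Complex.ofReal_zero, expInverse_zero]
    exact (hQ.tendsto_expInverse_apply hκ hinj x).comp tendsto_ofReal_nhdsGT
  · have h1 := ((hQ.differentiableOn_expInverse hκ).differentiableAt
      ((isOpen_cone κ).mem_nhds (ofReal_mem_cone ht))).continuousAt
    have h2 : ContinuousAt (fun s : ℝ => expInverse Q s) t :=
      ContinuousAt.comp (f := fun s : ℝ => (s : ℂ)) h1 Complex.continuous_ofReal.continuousAt
    exact (h2.clm_apply continuousAt_const).continuousWithinAt

/-- `Q⁻¹` generates the semigroup `expInverse Q`. -/
theorem tendsto_slope_iff (hQ : IsNegSectorial Q κ) (hκ : 0 < κ)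
    (hinj : Function.Injective Q) (x y : X) :
    Tendsto (fun t : ℝ => ((t⁻¹ : ℝ) : ℂ) • (expInverse Q t x - x)) (𝓝[>] 0) (𝓝 y) ↔
      x = Q y := by
  -- The orbit of Qy has derivative `expInverse Q t y` for t > 0, which tends to y; hence its
  -- one-sided derivative at 0 is y.
  have key : ∀ y : X, Tendsto (fun t : ℝ => ((t⁻¹ : ℝ) : ℂ) • (expInverse Q t (Q y) - Q y))
      (𝓝[>] 0) (𝓝 y) := by
    intro y
    have hd : ∀ t : ℝ, 0 < t →
        HasDerivAt (fun t : ℝ => Q (expInverse Q t y)) (expInverse Q t y) t := fun t ht => by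
      have h1 := (hQ.hasDerivAt_mul_expInverse hκ (ofReal_mem_cone ht)).scomp t
        Complex.ofRealCLM.hasDerivAt
      rw [Complex.ofRealCLM_apply, Complex.ofReal_one, one_smul] at h1
      exact ((ContinuousLinearMap.apply ℂ X y).restrictScalars ℝ).hasFDerivAt.comp_hasDerivAt t h1
    have h0 : Tendsto (fun t : ℝ => expInverse Q t y) (𝓝[>] 0) (𝓝 y) :=
      (hQ.tendsto_expInverse_apply hκ hinj y).comp tendsto_ofReal_nhdsGT
    have h1 : HasDerivWithinAt (fun t : ℝ => Q (expInverse Q t y)) y (Set.Ici 0) 0 := by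
      refine hasDerivWithinAt_Ici_of_tendsto_deriv (s := Set.Ioi 0)
        (fun t ht => (hd t ht).differentiableAt.differentiableWithinAt) ?_ self_mem_nhdsWithin ?_
      · rw [ContinuousWithinAt, Complex.ofReal_zero, expInverse_zero]
        exact (Q.continuous.tendsto y).comp h0
      · refine h0.congr' ?_
        filter_upwards [self_mem_nhdsWithin] with t ht
        exact (hd t ht).deriv.symm
    have h2 := hasDerivWithinAt_iff_tendsto_slope.mp h1
    rw [Set.Ici_sdiff_left] at h2
    refine h2.congr' ?_
    filter_upwards [self_mem_nhdsWithin] with t ht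
    have h3 : Q (expInverse Q t y) = expInverse Q t (Q y) :=
      congrArg (fun B : X →L[ℂ] X => B y)
        (hQ.commute_expInverse hκ (Commute.refl Q) (ofReal_mem_cone ht)).symm.eq
    rw [slope_def_module, h3, Complex.ofReal_zero, expInverse_zero, sub_zero]
    rfl
  constructor
  · intro h
    -- Applied to the difference quotient of x, Q gives that of Qx, whose limit is x by `key`; by
    -- continuity the limit is also Qy.
    refine tendsto_nhds_unique (key x) ?_
    refine ((Q.continuous.tendsto y).comp h).congr' ?_
    filter_upwards [self_mem_nhdsWithin] with t ht
    have h3 : Q (expInverse Q t x) = expInverse Q t (Q x) :=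
      congrArg (fun B : X →L[ℂ] X => B x)
        (hQ.commute_expInverse hκ (Commute.refl Q) (ofReal_mem_cone ht)).symm.eq
    simp only [Function.comp, map_smul, map_sub, h3]
  · rintro rfl
    exact key y

end IsNegSectorial

end SectorialSemigroup

/-! ### Gelfand theory in the bicommutant. -/

section Bicommutant

variable {𝔸 : Type*} [NormedRing 𝔸] [NormedAlgebra ℂ 𝔸]

/-- The bicommutant of an element of a complex Banach algebra. -/
abbrev bicommutant (q : 𝔸) : Subalgebra ℂ 𝔸 := Subalgebra.centralizer ℂ (Set.centralizer {q})

theorem mem_bicommutant {q a : 𝔸} : a ∈ bicommutant q ↔ ∀ b, Commute q b → Commute a b := by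
  rw [Subalgebra.mem_centralizer_iff]
  refine forall_congr' fun b => ?_
  rw [Set.mem_centralizer_iff]
  simp only [Set.mem_singleton_iff, forall_eq]
  exact ⟨fun h hb => (h hb).symm, fun h hb => (h hb).symm⟩

theorem self_mem_bicommutant (q : 𝔸) : q ∈ bicommutant q := mem_bicommutant.mpr fun _ h => h

theorem bicommutant_mul_comm (q : 𝔸) (a b : bicommutant q) : a * b = b * a :=
  Subtype.ext (mem_bicommutant.mp a.2 b (mem_bicommutant.mp b.2 q (Commute.refl q)).symm).eq

theorem spectrum_bicommutant_subset (q : 𝔸) (x : bicommutant q) :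
    spectrum ℂ x ⊆ spectrum ℂ (x : 𝔸) := by
  intro k hk hu
  refine hk ?_
  have hm : algebraMap ℂ 𝔸 k - x ∈ bicommutant q := (algebraMap ℂ (bicommutant q) k - x).2
  obtain ⟨u, hu⟩ := hu
  rw [← hu] at hm
  have hinv : ((u⁻¹ : 𝔸ˣ) : 𝔸) ∈ bicommutant q :=
    mem_bicommutant.mpr fun b hb => (mem_bicommutant.mp hm b hb).units_inv_left
  refine ⟨⟨⟨u, hm⟩, ⟨_, hinv⟩, Subtype.ext u.mul_inv, Subtype.ext u.inv_mul⟩, Subtype.ext hu⟩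

variable [CompleteSpace 𝔸]

/-- The bicommutant is commutative, closed and closed under inverses, so its characters attain every
spectral value of a and take values only in spectra relative to the full algebra. -/
theorem exists_character_bicommutant {q : 𝔸} (a : bicommutant q) {k : ℂ}
    (hk : k ∈ spectrum ℂ (a : 𝔸)) :
    ∃ χ : bicommutant q →ₐ[ℂ] ℂ, Continuous χ ∧ χ a = k ∧
      ∀ x : bicommutant q, χ x ∈ spectrum ℂ (x : 𝔸) := by
  let _ : NormedCommRing (bicommutant q) :=
    { (inferInstance : NormedRing (bicommutant q)) with mul_comm := bicommutant_mul_comm q }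
  have _ : CompleteSpace (bicommutant q) :=
    (Set.isClosed_centralizer (Set.centralizer {q})).completeSpace_coe
  have hk' : k ∈ spectrum ℂ a := AlgHom.spectrum_apply_subset (bicommutant q).val a hk
  obtain ⟨f, hf⟩ := WeakDual.CharacterSpace.mem_spectrum_iff_exists.mp hk'
  refine ⟨WeakDual.CharacterSpace.toAlgHom f, map_continuous f, hf, fun x => ?_⟩
  exact spectrum_bicommutant_subset q x (AlgHom.apply_mem_spectrum f x)

end Bicommutant

/-! ### Spectral mapping at time 1. -/

section SpectralMapping

open NormedSpace Filter

variable {X : Type*} [NormedAddCommGroup X] [InnerProductSpace ℂ X] [CompleteSpace X]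
variable {Q : X →L[ℂ] X} {κ : ℝ}

/-- Spectral mapping for the semigroup generated by `Q⁻¹`. -/
theorem IsNegSectorial.spectrum_expInverse_one (hQ : IsNegSectorial Q κ) (hκ : 0 < κ) {k : ℂ}
    (hk : k ∈ spectrum ℂ (expInverse Q 1)) :
    k = 0 ∨ ∃ μ ∈ spectrum ℂ Q, μ ≠ 0 ∧ k = Complex.exp μ⁻¹ := by
  let _ : NormedAlgebra ℚ (X →L[ℂ] X) := .restrictScalars ℚ ℂ _
  let _ : NormedAlgebra ℚ (bicommutant Q) := .restrictScalars ℚ ℂ _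
  have h1 : (1 : ℂ) ∈ cone κ := by simpa using ofReal_mem_cone (κ := κ) one_pos
  have hp : ∀ n : ℕ, (0 : ℝ) < (1 / 2) ^ n := fun n => by positivity
  have hY : ∀ n : ℕ, yosida Q ((1 / 2) ^ n) ∈ bicommutant Q := fun n =>
    mem_bicommutant.mpr fun b hb => hQ.commute_yosida hκ (hp n) hb
  have hE : ∀ n : ℕ, expApprox Q n 1 ∈ bicommutant Q := fun n =>
    mem_bicommutant.mpr fun b hb => hQ.commute_expApprox hκ hb n 1
  have hF : expInverse Q 1 ∈ bicommutant Q :=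
    mem_bicommutant.mpr fun b hb => hQ.commute_expInverse hκ hb h1
  obtain ⟨χ, hχ, hχk, hsp⟩ := exists_character_bicommutant ⟨_, hF⟩ hk
  obtain ⟨μ, hμ⟩ : ∃ μ, μ = χ ⟨Q, self_mem_bicommutant Q⟩ := ⟨_, rfl⟩
  have hcl : IsClosed (bicommutant Q : Set (X →L[ℂ] X)) :=
    Set.isClosed_centralizer (Set.centralizer {Q})
  have _ : CompleteSpace (bicommutant Q) := hcl.completeSpace_coe
  have hexp : ∀ n, (⟨_, hE n⟩ : bicommutant Q) = exp (⟨_, hY n⟩ : bicommutant Q) := fun n => by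
    apply Subtype.ext
    have h2 := map_exp (bicommutant Q).val continuous_subtype_val ⟨_, hY n⟩
    simp only [Subalgebra.coe_val] at h2
    rw [h2]
    exact congrArg exp (one_smul ℂ _)
  -- A character turns the resolvent into the scalar (μ - 2⁻ⁿ)⁻¹. For μ = 0 its exponential is
  -- exp(-2ⁿ), which accounts for the alternative k = 0.
  have hχY : ∀ n, χ ⟨_, hY n⟩ * (μ - ((1 / 2) ^ n : ℝ)) = 1 := fun n => by
    have h2 : (⟨_, hY n⟩ : bicommutant Q) * ⟨Q, self_mem_bicommutant Q⟩ =
        1 + (((1 / 2) ^ n : ℝ) : ℂ) • ⟨_, hY n⟩ := Subtype.ext (hQ.yosida_mul hκ (hp n))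
    have h3 := congrArg χ h2
    rw [map_mul, map_add, map_smul, map_one, ← hμ, smul_eq_mul] at h3
    linear_combination h3
  have hχE : ∀ n, χ ⟨_, hE n⟩ = Complex.exp (μ - ((1 / 2) ^ n : ℝ))⁻¹ := fun n => by
    rw [hexp, map_exp χ hχ, Complex.exp_eq_exp_ℂ, eq_inv_of_mul_eq_one_left (hχY n)]
  have hlim : Tendsto (fun n => χ ⟨_, hE n⟩) atTop (𝓝 k) := by
    rw [← hχk]
    exact (hχ.tendsto _).comp (tendsto_subtype_rng.mpr (hQ.tendsto_expApprox hκ h1))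
  simp only [hχE] at hlim
  have h2 : Tendsto (fun n : ℕ => (1 / 2 : ℝ) ^ n) atTop (𝓝 0) :=
    tendsto_pow_atTop_nhds_zero_of_lt_one (by norm_num) (by norm_num)
  rcases eq_or_ne μ 0 with h0 | h0
  · left
    refine tendsto_nhds_unique hlim ?_
    rw [h0, tendsto_zero_iff_norm_tendsto_zero]
    have h3 : Tendsto (fun n : ℕ => ((1 / 2 : ℝ) ^ n)⁻¹) atTop atTop :=
      tendsto_inv_nhdsGT_zero.comp (tendsto_nhdsWithin_iff.mpr ⟨h2, Eventually.of_forall hp⟩)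
    refine ((Real.tendsto_exp_neg_atTop_nhds_zero).comp h3).congr fun n => ?_
    rw [Complex.norm_exp, zero_sub, ← Complex.ofReal_neg, ← Complex.ofReal_inv, Complex.ofReal_re,
      inv_neg]
    rfl
  · right
    refine ⟨μ, hμ ▸ hsp ⟨Q, self_mem_bicommutant Q⟩, h0, tendsto_nhds_unique hlim ?_⟩
    have h3 : Tendsto (fun n : ℕ => μ - (((1 / 2 : ℝ) ^ n : ℝ) : ℂ)) atTop (𝓝 (μ - (0 : ℝ))) :=
      tendsto_const_nhds.sub ((Complex.continuous_ofReal.tendsto 0).comp h2)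
    rw [Complex.ofReal_zero, sub_zero] at h3
    exact (Complex.continuous_exp.tendsto _).comp (h3.inv₀ h0)

end SpectralMapping

/-! ### From the spectral radius to exponential decay. -/

section GrowthBound

open Filter

/-- The spectral radius of `S 1` controls the growth of a `C₀`-semigroup. -/
theorem exists_norm_le_exp_of_spectrum {X : Type*} [NormedAddCommGroup X] [NormedSpace ℂ X]
    [CompleteSpace X] [Nontrivial X] {S : ℝ → X →L[ℂ] X} (hS : IsC0Semigroup S) {ω B : ℝ}
    (hB : ∀ t, 0 ≤ t → t ≤ 1 → ‖S t‖ ≤ B)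
    (hσ : ∀ k ∈ spectrum ℂ (S 1), ‖k‖ < Real.exp (-ω)) :
    ∃ C : ℝ, ∀ t, 0 ≤ t → ‖S t‖ ≤ C * Real.exp (-ω * t) := by
  have hpow : ∀ n : ℕ, S n = S 1 ^ n := by
    intro n
    induction n with
    | zero =>
      rw [Nat.cast_zero, hS.map_zero, pow_zero]
      rfl
    | succ n ih =>
      rw [Nat.cast_succ, hS.map_add _ _ (Nat.cast_nonneg n) zero_le_one, ih, pow_succ]
      rfl
  -- The radius is attained at a spectral point, so the strict inequality survives the supremum and
  -- the exponent ω is reached without loss.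
  obtain ⟨k, hk, hkr⟩ := spectrum.exists_nnnorm_eq_spectralRadius (S 1)
  have hlim := spectrum.pow_norm_pow_one_div_tendsto_nhds_spectralRadius (S 1)
  rw [← hkr] at hlim
  have hlt : ((‖k‖₊ : NNReal) : ENNReal) < ENNReal.ofReal (Real.exp (-ω)) := by
    rw [← ENNReal.ofReal_coe_nnreal, coe_nnnorm]
    exact (ENNReal.ofReal_lt_ofReal_iff (Real.exp_pos _)).mpr (hσ k hk)
  obtain ⟨N, hN⟩ := eventually_atTop.mp (hlim.eventually_lt_const hlt)
  have hn : ∀ n : ℕ, N + 1 ≤ n → ‖S 1 ^ n‖ ≤ Real.exp (-ω) ^ n := fun n hn => by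
    have h1 := (ENNReal.ofReal_lt_ofReal_iff (Real.exp_pos _)).mp (hN n (by omega))
    have h2 : (0 : ℝ) < n := by exact_mod_cast (show 0 < n by omega)
    have h3 := Real.rpow_le_rpow (Real.rpow_nonneg (norm_nonneg _) _) h1.le h2.le
    rwa [← Real.rpow_mul (norm_nonneg _), one_div_mul_cancel h2.ne', Real.rpow_one,
      Real.rpow_natCast] at h3
  obtain ⟨C, hC0, hC⟩ : ∃ C : ℝ, 0 ≤ C ∧ ∀ n : ℕ, ‖S 1 ^ n‖ ≤ C * Real.exp (-ω) ^ n := by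
    refine ⟨1 + ∑ n ∈ Finset.range (N + 1), ‖S 1 ^ n‖ / Real.exp (-ω) ^ n, by positivity,
      fun n => ?_⟩
    have hpos : 0 < Real.exp (-ω) ^ n := by positivity
    rcases le_or_gt (N + 1) n with h | h
    · refine (hn n h).trans (le_mul_of_one_le_left hpos.le ?_)
      exact le_add_of_nonneg_right (by positivity)
    · rw [← div_le_iff₀ hpos]
      have h1 := Finset.single_le_sum (f := fun n => ‖S 1 ^ n‖ / Real.exp (-ω) ^ n)
        (fun i _ => by positivity) (Finset.mem_range.mpr h)
      linarith
  have hB0 : 0 ≤ B := (norm_nonneg _).trans (hB 0 le_rfl zero_le_one)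
  refine ⟨B * C * Real.exp |ω|, fun t ht => ?_⟩
  obtain ⟨n, hnt⟩ : ∃ n, n = ⌊t⌋₊ := ⟨_, rfl⟩
  have h1 : (n : ℝ) ≤ t := hnt ▸ Nat.floor_le ht
  have h2 : t < n + 1 := hnt ▸ Nat.lt_floor_add_one t
  have h3 : S t = (S (t - n)).comp (S n) := by
    rw [← hS.map_add _ _ (by linarith) (Nat.cast_nonneg n), sub_add_cancel]
  rw [h3, hpow]
  refine (ContinuousLinearMap.opNorm_comp_le _ _).trans ?_
  refine (mul_le_mul (hB _ (by linarith) (by linarith)) (hC n) (norm_nonneg _) hB0).trans ?_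
  rw [mul_assoc, mul_assoc]
  refine mul_le_mul_of_nonneg_left (mul_le_mul_of_nonneg_left ?_ hC0) hB0
  rw [← Real.exp_nat_mul, ← Real.exp_add]
  apply Real.exp_le_exp.mpr
  have h4 : ω * (t - n) ≤ |ω| * 1 :=
    mul_le_mul (le_abs_self ω) (by linarith) (by linarith) (abs_nonneg _)
  linarith

end GrowthBound

/-! ### Generation theorem for operators with sectorial numerical range. -/

section SectorialGenerator

open Filter

theorem sector_subset_cone {κ : ℝ} (hκ : 0 < κ) : sector (Real.arctan κ⁻¹) ⊆ cone κ := by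
  rintro z ⟨hz, harg⟩
  have h1 : |z.arg| < Real.pi / 2 := harg.trans (Real.arctan_lt_pi_div_two _)
  have hre : 0 < z.re := by
    rcases Complex.abs_arg_lt_pi_div_two_iff.mp h1 with h | h
    · exact h
    · exact absurd h hz
  have h2 : Real.tan |z.arg| < κ⁻¹ := by
    rw [← Real.tan_arctan κ⁻¹]
    exact Real.tan_lt_tan_of_lt_of_lt_pi_div_two
      (by linarith [abs_nonneg z.arg, Real.pi_pos]) (Real.arctan_lt_pi_div_two _) harg
  have h3 : Real.tan |z.arg| = |z.im| / z.re := by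
    rcases abs_cases z.arg with ⟨h, h0⟩ | ⟨h, h0⟩
    · rw [h, Complex.tan_arg, abs_of_nonneg (Complex.arg_nonneg_iff.mp h0)]
    · rw [h, Real.tan_neg, Complex.tan_arg, abs_of_neg (Complex.arg_neg_iff.mp h0), neg_div]
  rw [h3, div_lt_iff₀ hre, inv_mul_eq_div, lt_div_iff₀ hκ] at h2
  show κ * |z.im| < z.re
  linarith

theorem tendsto_inv_mul_exp_sub_one (c : ℂ) :
    Tendsto (fun t : ℝ => ((t⁻¹ : ℝ) : ℂ) * (Complex.exp (c * t) - 1)) (𝓝[>] 0) (𝓝 c) := by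
  have h1 : HasDerivAt (fun t : ℝ => Complex.exp (c * t)) c 0 := by
    have h2 := ((Complex.ofRealCLM.hasDerivAt (x := 0)).const_mul c).cexp
    simpa using h2
  have h2 := (hasDerivAt_iff_tendsto_slope.mp h1).mono_left
    (nhdsWithin_mono 0 fun t (ht : (0 : ℝ) < t) => ne_of_gt ht)
  refine h2.congr fun t => ?_
  rw [slope_def_module, Complex.ofReal_zero, mul_zero, Complex.exp_zero, sub_zero]
  rfl

variable {X : Type*} [NormedAddCommGroup X] [InnerProductSpace ℂ X]

/-- Multiplying the semigroup by e^{ct} adds c to its generator; this undoes the shift from T to T -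
c. -/
theorem tendsto_exp_smul_slope_iff (F : ℝ → X →L[ℂ] X) (c : ℂ) (x y : X) :
    Tendsto (fun t : ℝ => ((t⁻¹ : ℝ) : ℂ) • (Complex.exp (c * t) • F t x - x)) (𝓝[>] 0) (𝓝 y) ↔
      Tendsto (fun t : ℝ => ((t⁻¹ : ℝ) : ℂ) • (F t x - x)) (𝓝[>] 0) (𝓝 (y - c • x)) := by
  have h1 := tendsto_inv_mul_exp_sub_one c
  have hexp : ∀ d : ℂ, Tendsto (fun t : ℝ => Complex.exp (d * t)) (𝓝[>] 0) (𝓝 1) := fun d =>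
    tendsto_nhdsWithin_of_tendsto_nhds (Continuous.tendsto' (by fun_prop) _ _ (by simp))
  constructor
  · intro h
    have h2 := (hexp (-c)).smul (h.sub (h1.smul_const x))
    rw [one_smul] at h2
    refine h2.congr fun t => ?_
    have h3 : Complex.exp (-c * t) * Complex.exp (c * t) = 1 := by
      rw [← Complex.exp_add, neg_mul, neg_add_cancel, Complex.exp_zero]
    have h4 : Complex.exp (c * t) • F t x - x - (Complex.exp (c * t) - 1) • x =
        Complex.exp (c * t) • (F t x - x) := by
      module
    rw [mul_smul, ← smul_sub, h4, smul_comm (Complex.exp (-c * t)), smul_smul (Complex.exp (-c * t)),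
      h3, one_smul]
  · intro h
    have h2 := ((hexp c).smul h).add (h1.smul_const x)
    rw [one_smul, sub_add_cancel] at h2
    refine h2.congr fun t => ?_
    rw [smul_comm, mul_smul, ← smul_add]
    congr 1
    module

section Resolvent

variable {T : X →ₗ.[ℂ] X}

theorem mem_graph_iff_of_resolvent {c : ℂ} {R : X →L[ℂ] X}
    (h₁ : ∀ x : T.domain, R (c • (x : X) - T x) = x)
    (h₂ : ∀ y : X, ∃ x : T.domain, R y = x ∧ c • (x : X) - T x = y) (x y : X) :
    (x, y) ∈ T.graph ↔ R (c • x - y) = x := by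
  rw [LinearPMap.mem_graph_iff]
  constructor
  · rintro ⟨w, rfl, rfl⟩
    exact h₁ w
  · intro h
    obtain ⟨w, hw, hw'⟩ := h₂ (c • x - y)
    rw [h] at hw
    refine ⟨w, hw.symm, ?_⟩
    rw [← hw] at hw'
    exact sub_right_injective hw'

theorem resolvent_identity {c z : ℂ} {R R' : X →L[ℂ] X}
    (h₁ : ∀ x : T.domain, R (c • (x : X) - T x) = x)
    (h₂' : ∀ y : X, ∃ x : T.domain, R' y = x ∧ z • (x : X) - T x = y) (y : X) :
    R' y = R y + (c - z) • R (R' y) := by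
  obtain ⟨x, hx, hxy⟩ := h₂' y
  have h := h₁ x
  have h3 : c • (x : X) - T x = y + (c - z) • (x : X) := by
    rw [← hxy]
    module
  rw [h3, map_add, map_smul] at h
  rw [hx]
  exact h.symm

/-- If R' is the resolvent of T at c + μ⁻¹, then μ + R has the inverse μ⁻¹(1 - μ⁻¹R'), by the
resolvent identity in both orders. -/
theorem mem_opSpectrum_of_mem_spectrum {c : ℂ} {R : X →L[ℂ] X}
    (h₁ : ∀ x : T.domain, R (c • (x : X) - T x) = x)
    (h₂ : ∀ y : X, ∃ x : T.domain, R y = x ∧ c • (x : X) - T x = y) {μ : ℂ}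
    (hμ : μ ∈ spectrum ℂ (-R)) (hμ0 : μ ≠ 0) : c + μ⁻¹ ∈ opSpectrum T := by
  rintro ⟨R', h₁', h₂'⟩
  refine hμ ?_
  have e1 : ∀ y, μ • R' y + R (R' y) = μ • R y := fun y => by
    have h := congrArg (fun v => μ • v) (resolvent_identity h₁ h₂' y)
    have h3 : μ * (c - (c + μ⁻¹)) = -1 := by field_simp; ring
    simp only [smul_add, smul_smul, h3] at h
    rw [h]
    module
  have e2 : ∀ y, μ • R y = μ • R' y + R' (R y) := fun y => by
    have h := congrArg (fun v => μ • v) (resolvent_identity h₁' h₂ y)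
    have h3 : μ * (c + μ⁻¹ - c) = 1 := by field_simp; ring
    simp only [smul_add, smul_smul, h3, one_smul] at h
    exact h
  let U : X →L[ℂ] X := μ⁻¹ • (1 - μ⁻¹ • R')
  have hl : (algebraMap ℂ (X →L[ℂ] X) μ - -R) * U = 1 := by
    ext y
    have h : μ⁻¹ • μ⁻¹ • (μ • R' y + R (R' y)) = μ⁻¹ • μ⁻¹ • μ • R y := by rw [e1]
    rw [smul_add, smul_add, smul_smul μ⁻¹ μ, smul_smul μ⁻¹ μ, inv_mul_cancel₀ hμ0, one_smul,
      one_smul] at h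
    show μ • (U y) - -R (U y) = y
    have hU : U y = μ⁻¹ • (y - μ⁻¹ • R' y) := rfl
    rw [hU, map_smul, map_sub, map_smul, smul_smul, mul_inv_cancel₀ hμ0, one_smul, smul_sub,
      ← h]
    module
  have hr : U * (algebraMap ℂ (X →L[ℂ] X) μ - -R) = 1 := by
    ext y
    have h : R' (μ • y - -R y) = μ • R y := by rw [sub_neg_eq_add, map_add, map_smul, ← e2]
    show μ⁻¹ • ((μ • y - -R y) - μ⁻¹ • R' (μ • y - -R y)) = y
    rw [h, smul_smul, inv_mul_cancel₀ hμ0, one_smul, sub_neg_eq_add, add_sub_cancel_right,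
      smul_smul, inv_mul_cancel₀ hμ0, one_smul]
  exact ⟨⟨_, U, hl, hr⟩, rfl⟩

end Resolvent

variable [CompleteSpace X]

/-- Generation theorem for operators with numerical range in a sector, with the growth bound
given by the spectrum. -/
theorem exists_analytic_semigroup [Nontrivial X] {T : X →ₗ.[ℂ] X} {c κ ω : ℝ} (hκ : 0 < κ)
    (hT : ∀ x : T.domain, |(⟪(x : X), T x - (c : ℂ) • (x : X)⟫_ℂ).im| ≤
      κ * -(⟪(x : X), T x - (c : ℂ) • (x : X)⟫_ℂ).re)
    (hc : (c : ℂ) ∉ opSpectrum T) (hσ : ∀ z ∈ opSpectrum T, z.re < -ω) :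
    ∃ S : ℝ → X →L[ℂ] X, IsC0Semigroup S ∧ IsGenerator T S ∧ IsAnalyticSemigroup S ∧
      ∃ C : ℝ, ∀ t : ℝ, 0 ≤ t → ‖S t‖ ≤ C * Real.exp (-ω * t) := by
  rw [opSpectrum, Set.notMem_compl_iff] at hc
  obtain ⟨R, h₁, h₂⟩ := hc
  have hinj : Function.Injective (-R) := by
    rw [injective_iff_map_eq_zero]
    intro y hy
    obtain ⟨x, hx, hxy⟩ := h₂ y
    have hx0 : (x : X) = 0 := by
      rw [← hx]
      exact neg_eq_zero.mp hy
    have : x = 0 := Subtype.ext hx0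
    rw [← hxy, this]
    simp
  have hQ : IsNegSectorial (-R) κ := by
    intro y
    obtain ⟨x, hx, hxy⟩ := h₂ y
    -- With y = (c - T)x, inversion conjugates the values of the form, and the sector is symmetric
    -- under conjugation.
    have h : ⟪y, (-R) y⟫_ℂ = (starRingEnd ℂ) ⟪(x : X), T x - (c : ℂ) • (x : X)⟫_ℂ := by
      rw [inner_conj_symm, neg_apply, hx, inner_neg_right, ← inner_neg_left, ← hxy, neg_sub]
    rw [h, Complex.conj_re, Complex.conj_im, abs_neg]
    exact hT x
  obtain ⟨F, hF⟩ : ∃ F : ℂ → X →L[ℂ] X,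
      F = fun z => Complex.exp (c * z) • expInverse (-R) z := ⟨_, rfl⟩
  have hadd : ∀ z ∈ cone κ, ∀ w ∈ cone κ, F (z + w) = (F z).comp (F w) := by
    intro z hz w hw
    rw [hF]
    simp only
    rw [hQ.expInverse_add hκ hz hw, ContinuousLinearMap.smul_comp,
      ContinuousLinearMap.comp_smul, smul_smul, mul_add, Complex.exp_add]
    rfl
  have hF0 : F 0 = ContinuousLinearMap.id ℂ X := by
    rw [hF]
    simp only [mul_zero, Complex.exp_zero, one_smul, expInverse_zero]
    rfl
  have hsem : IsC0Semigroup fun t : ℝ => F t := by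
    refine ⟨by simpa using hF0, fun s t hs ht => ?_, fun x => ?_⟩
    · rcases hs.eq_or_lt with rfl | hs
      · rw [zero_add, Complex.ofReal_zero, hF0, ContinuousLinearMap.id_comp]
      rcases ht.eq_or_lt with rfl | ht
      · rw [add_zero, Complex.ofReal_zero, hF0, ContinuousLinearMap.comp_id]
      rw [Complex.ofReal_add]
      exact hadd _ (ofReal_mem_cone hs) _ (ofReal_mem_cone ht)
    · rw [hF]
      exact ContinuousOn.smul (by fun_prop) (hQ.continuousOn_expInverse_apply hκ hinj x)
  refine ⟨fun t => F t, hsem, ?_, ?_, ?_⟩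
  · intro x y
    rw [hF, mem_graph_iff_of_resolvent h₁ h₂]
    have h := (tendsto_exp_smul_slope_iff (fun t : ℝ => expInverse (-R) t) c x y).trans
      (hQ.tendsto_slope_iff hκ hinj x (y - (c : ℂ) • x))
    refine Iff.trans ?_ h.symm
    rw [neg_apply, ← map_neg, neg_sub, eq_comm]
  · refine ⟨Real.arctan κ⁻¹, Real.arctan_pos.mpr (inv_pos.mpr hκ),
      (Real.arctan_lt_pi_div_two _).le, F, fun t _ => rfl, fun z hz w hw =>
      hadd z (sector_subset_cone hκ hz) w (sector_subset_cone hκ hw), ?_, fun φ' _ hφ' x => ?_⟩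
    · rw [hF]
      exact DifferentiableOn.smul (c := fun z : ℂ => Complex.exp (c * z)) (by fun_prop)
        ((hQ.differentiableOn_expInverse hκ).mono (sector_subset_cone hκ))
    · have hsub : sector φ' ⊆ cone κ := fun z hz =>
        sector_subset_cone hκ ⟨hz.1, hz.2.trans hφ'⟩
      have h1 := (hQ.tendsto_expInverse_apply hκ hinj x).mono_left (nhdsWithin_mono 0 hsub)
      have h2 : Tendsto (fun z : ℂ => Complex.exp (c * z)) (𝓝[sector φ'] 0) (𝓝 1) :=
        tendsto_nhdsWithin_of_tendsto_nhds (Continuous.tendsto' (by fun_prop) _ _ (by simp))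
      have h3 := h2.smul h1
      rw [one_smul] at h3
      rw [hF]
      exact h3
  · refine exists_norm_le_exp_of_spectrum hsem (B := Real.exp |c|) (fun t ht ht1 => ?_)
      fun k hk => ?_
    · rcases ht.eq_or_lt with rfl | ht
      · rw [Complex.ofReal_zero, hF0]
        exact ContinuousLinearMap.norm_id_le.trans (Real.one_le_exp (abs_nonneg c))
      · rw [hF]
        simp only
        rw [norm_smul, ← Complex.ofReal_mul, Complex.norm_exp, Complex.ofReal_re]
        refine (mul_le_of_le_one_right (Real.exp_pos _).le
          (hQ.norm_expInverse_le hκ (ofReal_mem_cone ht))).trans (Real.exp_le_exp.mpr ?_)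
        have h4 := mul_le_mul (le_abs_self c) ht1 ht.le (abs_nonneg c)
        linarith
    · obtain ⟨u, hu⟩ : ∃ u : ℂˣ, (u : ℂ) = Complex.exp c := ⟨Units.mk0 _ (Complex.exp_ne_zero _), rfl⟩
      have h1 : F (1 : ℝ) = u • expInverse (-R) 1 := by
        rw [hF, Units.smul_def, hu]
        simp
      have h2 : k = u • (u⁻¹ • k) := by rw [smul_inv_smul]
      rw [h1, h2, spectrum.smul_mem_smul_iff] at hk
      rcases hQ.spectrum_expInverse_one hκ hk with h0 | ⟨μ, hμ, hμ0, hkμ⟩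
      · rw [h2, h0, smul_zero, norm_zero]
        exact Real.exp_pos _
      · have h3 := hσ _ (mem_opSpectrum_of_mem_spectrum h₁ h₂ hμ hμ0)
        rw [h2, hkμ, Units.smul_def, hu, smul_eq_mul, ← Complex.exp_add, Complex.norm_exp]
        exact Real.exp_lt_exp.mpr h3

end SectorialGenerator

/-! ### Reduction of the damped equation to operators on H₁. -/

section Application

variable {H : Type*} [NormedAddCommGroup H] [InnerProductSpace ℂ H] [CompleteSpace H]
variable {A : H →ₗ.[ℂ] H} (hA : IsPosDefSelfAdjoint A) (D : H₁ hA →L[ℂ] Hneg hA)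

/-- `A` as an isometric isomorphism of `H₁` onto `H₋₁`. -/
noncomputable def extIso : H₁ hA ≃ₗᵢ[ℂ] Hneg hA :=
  LinearIsometryEquiv.ofSurjective ⟨(extOp hA : H₁ hA →ₗ[ℂ] Hneg hA), norm_extOp_apply hA⟩
    (extOp_surjective hA)

theorem extIso_apply (x : H₁ hA) : extIso hA x = extOp hA x := rfl

theorem extOp_symm (f : Hneg hA) : extOp hA ((extIso hA).symm f) = f :=
  (extIso hA).apply_symm_apply f

theorem inner_extIso_symm (f : Hneg hA) (y : H₁ hA) : ⟪y, (extIso hA).symm f⟫_ℂ = f y := by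
  rw [← extOp_apply, extOp_symm]

/-- `A⁻¹` as an operator on `H₁`. -/
noncomputable def massOp : H₁ hA →L[ℂ] H₁ hA :=
  ((extIso hA).symm : Hneg hA →L[ℂ] H₁ hA).comp ((embNeg hA).comp (incl hA))

/-- `A⁻¹ D` as an operator on `H₁`. -/
noncomputable def dampOp : H₁ hA →L[ℂ] H₁ hA :=
  ((extIso hA).symm : Hneg hA →L[ℂ] H₁ hA).comp D

theorem inner_massOp (x y : H₁ hA) : ⟪y, massOp hA x⟫_ℂ = ⟪incl hA y, incl hA x⟫_ℂ :=
  (inner_extIso_symm hA _ y).trans (embNeg_apply hA _ y)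

theorem inner_dampOp (x y : H₁ hA) : ⟪y, dampOp hA D x⟫_ℂ = D x y := inner_extIso_symm hA _ y

theorem norm_massOp (x : H₁ hA) : ‖massOp hA x‖ = ‖embNeg hA (incl hA x)‖ :=
  (extIso hA).symm.norm_map _

theorem pencil_apply (z : ℂ) (x : H₁ hA) :
    pencil hA D z x = z ^ 2 • embNeg hA (incl hA x) + z • D x + extOp hA x := rfl

theorem extIso_opPencil (z : ℂ) (x : H₁ hA) :
    extIso hA (opPencil (massOp hA) (dampOp hA D) z x) = pencil hA D z x := by
  have h1 : extIso hA (massOp hA x) = embNeg hA (incl hA x) := extOp_symm hA _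
  have h2 : extIso hA (dampOp hA D x) = D x := extOp_symm hA _
  rw [opPencil_apply, map_add, map_add, map_smul, map_smul, h1, h2, pencil_apply, extIso_apply]

theorem notMem_pencilSpectrum_of_isUnit {z : ℂ}
    (h : IsUnit (opPencil (massOp hA) (dampOp hA D) z)) : z ∉ pencilSpectrum hA D := by
  obtain ⟨u, hu⟩ := h
  rw [pencilSpectrum, Set.notMem_compl_iff]
  refine ⟨(↑u⁻¹ : H₁ hA →L[ℂ] H₁ hA).comp ((extIso hA).symm : Hneg hA →L[ℂ] H₁ hA), ?_, ?_⟩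
  · refine ContinuousLinearMap.ext fun x => ?_
    show (↑u⁻¹ : H₁ hA →L[ℂ] H₁ hA) ((extIso hA).symm (pencil hA D z x)) = x
    rw [← extIso_opPencil, LinearIsometryEquiv.symm_apply_apply, ← hu]
    exact congrArg (fun B : H₁ hA →L[ℂ] H₁ hA => B x) u.inv_mul
  · refine ContinuousLinearMap.ext fun f => ?_
    show pencil hA D z ((↑u⁻¹ : H₁ hA →L[ℂ] H₁ hA) ((extIso hA).symm f)) = f
    rw [← extIso_opPencil, ← hu]
    have h1 := congrArg (fun B : H₁ hA →L[ℂ] H₁ hA => B ((extIso hA).symm f)) u.mul_inv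
    exact (congrArg (extIso hA) h1).trans ((extIso hA).apply_symm_apply f)

section Damping

variable {hA} {D} {ν : ℝ}

/-- Accretivity bounds the quotients below by 0, so the real infimum is genuine; it also settles the
case f x = 0. -/
theorem le_of_iInf_div (hD : IsAccretiveSectorial hA D ν) (f : H₁ hA → ℝ)
    (hf : f 0 = 0) (x : H₁ hA) :
    (⨅ x : {x : H₁ hA // x ≠ 0}, (D x.1 x.1).re / f x.1 ^ 2) * f x ^ 2 ≤ (D x x).re := by
  rcases eq_or_ne (f x) 0 with h0 | h0
  · rw [h0]
    simpa using hD.accretive x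
  · have hx : x ≠ 0 := fun h => h0 (h ▸ hf)
    rw [← le_div_iff₀ (by positivity)]
    exact ciInf_le (f := fun x : {x : H₁ hA // x ≠ 0} => (D x.1 x.1).re / f x.1 ^ 2)
      ⟨0, by
        rintro _ ⟨y, rfl⟩
        exact div_nonneg (hD.accretive _) (sq_nonneg _)⟩ ⟨x, hx⟩

theorem pencilBounds (hD : IsAccretiveSectorial hA D ν) :
    PencilBounds (massOp hA) (dampOp hA D) (dampAlpha hA D) (dampBeta hA D) (dampDelta hA D)
      ‖D‖ ν := by
  refine ⟨fun x y => ?_, fun x => ?_, fun x => ?_, fun x => ?_, fun x => ?_, ?_, fun x => ?_⟩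
  · show ⟪massOp hA x, y⟫_ℂ = ⟪x, massOp hA y⟫_ℂ
    rw [← inner_conj_symm, inner_massOp, inner_massOp, inner_conj_symm]
  · show 0 ≤ (⟪x, massOp hA x⟫_ℂ).re
    rw [inner_massOp]
    exact inner_self_nonneg (𝕜 := ℂ)
  · show _ ≤ (⟪x, dampOp hA D x⟫_ℂ).re
    rw [inner_dampOp, norm_massOp]
    exact le_of_iInf_div hD (fun x => ‖embNeg hA (incl hA x)‖) (by simp) x
  · show _ * (⟪x, massOp hA x⟫_ℂ).re ≤ (⟪x, dampOp hA D x⟫_ℂ).re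
    have h : (⟪incl hA x, incl hA x⟫_ℂ).re = ‖incl hA x‖ ^ 2 :=
      (norm_sq_eq_re_inner (𝕜 := ℂ) _).symm
    rw [inner_dampOp, inner_massOp, h]
    exact le_of_iInf_div hD (fun x => ‖incl hA x‖) (by simp) x
  · show _ ≤ (⟪x, dampOp hA D x⟫_ℂ).re
    rw [inner_dampOp]
    exact le_of_iInf_div hD (fun x => ‖x‖) (by simp) x
  · refine ContinuousLinearMap.opNorm_le_bound _ (norm_nonneg D) fun x => ?_
    exact ((extIso hA).symm.norm_map (D x)).le.trans (D.le_opNorm x)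
  · show |(⟪x, dampOp hA D x⟫_ℂ).im| ≤ ν * (⟪x, dampOp hA D x⟫_ℂ).re
    rw [inner_dampOp]
    exact hD.sectorial x

theorem dampDelta_mul_le (hD : IsAccretiveSectorial hA D ν) (x : H₁ hA) :
    dampDelta hA D * ‖x‖ ^ 2 ≤ (D x x).re :=
  le_of_iInf_div hD (fun x => ‖x‖) (by simp) x

/-- On the zero space the infimum runs over the empty set and has the default value 0. -/
theorem nontrivial_of_dampDelta_pos (hδ : 0 < dampDelta hA D) : Nontrivial (H₁ hA) := by
  by_contra h
  have : Subsingleton (H₁ hA) := not_nontrivial_iff_subsingleton.mp h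
  have : IsEmpty {x : H₁ hA // x ≠ 0} := ⟨fun x => x.2 (Subsingleton.elim _ _)⟩
  rw [dampDelta, Real.iInf_of_isEmpty] at hδ
  exact lt_irrefl _ hδ

/-- Norms weaker than that of H₁ inherit positivity from δ; this is the common reason for α > 0 and
β > 0. -/
theorem iInf_div_pos (hD : IsAccretiveSectorial hA D ν) (hδ : 0 < dampDelta hA D)
    {Y : Type*} [NormedAddCommGroup Y] [NormedSpace ℂ Y] (B : H₁ hA →L[ℂ] Y)
    (hB : Function.Injective B) :
    0 < ⨅ x : {x : H₁ hA // x ≠ 0}, (D x.1 x.1).re / ‖B x.1‖ ^ 2 := by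
  have := nontrivial_of_dampDelta_pos hδ
  obtain ⟨x, hx⟩ := exists_ne (0 : H₁ hA)
  have : Nonempty {x : H₁ hA // x ≠ 0} := ⟨⟨x, hx⟩⟩
  refine lt_of_lt_of_le (show 0 < dampDelta hA D / (‖B‖ + 1) ^ 2 by positivity)
    (le_ciInf fun y => ?_)
  have hy : 0 < ‖B y.1‖ :=
    norm_pos_iff.mpr fun h => y.2 ((injective_iff_map_eq_zero B).mp hB _ h)
  rw [div_le_div_iff₀ (by positivity) (by positivity)]
  have h1 : ‖B y.1‖ ≤ (‖B‖ + 1) * ‖y.1‖ :=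
    (B.le_opNorm _).trans (mul_le_mul_of_nonneg_right (by linarith) (norm_nonneg _))
  have h2 := pow_le_pow_left₀ (norm_nonneg _) h1 2
  have h3 := dampDelta_mul_le hD y.1
  calc dampDelta hA D * ‖B y.1‖ ^ 2 ≤ dampDelta hA D * ((‖B‖ + 1) * ‖y.1‖) ^ 2 :=
        mul_le_mul_of_nonneg_left h2 hδ.le
    _ = dampDelta hA D * ‖y.1‖ ^ 2 * (‖B‖ + 1) ^ 2 := by ring
    _ ≤ _ := mul_le_mul_of_nonneg_right h3 (sq_nonneg _)

theorem dampAlpha_pos (hD : IsAccretiveSectorial hA D ν) (hδ : 0 < dampDelta hA D) :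
    0 < dampAlpha hA D :=
  iInf_div_pos hD hδ ((embNeg hA).comp (incl hA))
    ((embNeg_injective hA).comp (incl_injective hA))

theorem dampBeta_pos (hD : IsAccretiveSectorial hA D ν) (hδ : 0 < dampDelta hA D) :
    0 < dampBeta hA D :=
  iInf_div_pos hD hδ (incl hA) (incl_injective hA)

theorem dampDelta_le_norm (hD : IsAccretiveSectorial hA D ν) (hδ : 0 < dampDelta hA D) :
    dampDelta hA D ≤ ‖D‖ := by
  have := nontrivial_of_dampDelta_pos hδ
  obtain ⟨x, hx⟩ := exists_ne (0 : H₁ hA)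
  have hx0 := norm_pos_iff.mpr hx
  have h3 := dampDelta_mul_le hD x
  have h4 : (D x x).re ≤ ‖D‖ * ‖x‖ * ‖x‖ := (Complex.re_le_norm _).trans (D.le_opNorm₂ x x)
  refine le_of_mul_le_mul_right ?_ (pow_pos hx0 2)
  linarith

end Damping

/-! ### Spectrum and numerical range of the generator. -/

variable {hA} {D}

theorem mem_genDomain {v : H₁ hA} {w₂ : H₁ hA} {h : H}
    (hh : embNeg hA h = D v + extOp hA w₂) :
    ∃ w : (generator hA D).domain, (w : Energy hA) = WithLp.toLp 2 (incl hA v, w₂) ∧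
      generator hA D w = WithLp.toLp 2 (-h, v) := by
  refine ⟨⟨WithLp.toLp 2 (incl hA v, w₂), v, rfl, h, hh⟩, rfl, ?_⟩
  set w : genDomain hA D := ⟨WithLp.toLp 2 (incl hA v, w₂), v, rfl, h, hh⟩
  have h1 : genFst hA D w = v := incl_injective hA (incl_genFst hA D w)
  have h2 : genSum hA D w = h := embNeg_injective hA (by
    rw [embNeg_genSum, h1, hh]
    rfl)
  show WithLp.toLp 2 (-genSum hA D w, genFst hA D w) = _
  rw [h1, h2]

theorem exists_of_mem_domain (w : (generator hA D).domain) : ∃ (v w₂ : H₁ hA) (h : H),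
    embNeg hA h = D v + extOp hA w₂ ∧ (w : Energy hA) = WithLp.toLp 2 (incl hA v, w₂) ∧
      generator hA D w = WithLp.toLp 2 (-h, v) := by
  refine ⟨genFst hA D w, w.1.snd, genSum hA D w, embNeg_genSum hA D w, ?_, rfl⟩
  have h : incl hA (genFst hA D w) = (w : Energy hA).fst := incl_genFst hA D w
  rw [h]
  rfl

/-- Eliminating w₂ from (z - T)w = y gives L(z)w₁ = z y₁ - A y₂. Then w₂ is recovered as A⁻¹(y₁ - z
w₁ - D w₁) without dividing by z, so z = 0 needs no separate case. -/
theorem notMem_opSpectrum_of_notMem_pencilSpectrum {z : ℂ} (hz : z ∉ pencilSpectrum hA D) :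
    z ∉ opSpectrum (generator hA D) := by
  rw [pencilSpectrum, Set.notMem_compl_iff] at hz
  obtain ⟨P, hP₁, hP₂⟩ := hz
  have hP₁' : ∀ x, P (pencil hA D z x) = x := fun x =>
    congrArg (fun B : H₁ hA →L[ℂ] H₁ hA => B x) hP₁
  have hP₂' : ∀ f, pencil hA D z (P f) = f := fun f =>
    congrArg (fun B : Hneg hA →L[ℂ] Hneg hA => B f) hP₂
  let V : Energy hA →L[ℂ] H₁ hA := P.comp (z • (embNeg hA).comp (WithLp.fstL 2 ℂ H (H₁ hA)) -
    (extOp hA).comp (WithLp.sndL 2 ℂ H (H₁ hA)))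
  let W : Energy hA →L[ℂ] H₁ hA := ((extIso hA).symm : Hneg hA →L[ℂ] H₁ hA).comp
    ((embNeg hA).comp (WithLp.fstL 2 ℂ H (H₁ hA)) -
      z • ((embNeg hA).comp (incl hA)).comp V - D.comp V)
  let R : Energy hA →L[ℂ] Energy hA :=
    ((WithLp.prodContinuousLinearEquiv 2 ℂ H (H₁ hA)).symm : H × H₁ hA →L[ℂ] Energy hA).comp
      (((incl hA).comp V).prod W)
  have hV : ∀ y : Energy hA, V y = P (z • embNeg hA y.fst - extOp hA y.snd) := fun _ => rfl
  have hW : ∀ y : Energy hA, extOp hA (W y) =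
      embNeg hA y.fst - z • embNeg hA (incl hA (V y)) - D (V y) := fun _ => extOp_symm hA _
  have hR : ∀ y, R y = WithLp.toLp 2 (incl hA (V y), W y) := fun _ => rfl
  have hLV : ∀ y : Energy hA, z ^ 2 • embNeg hA (incl hA (V y)) + z • D (V y) + extOp hA (V y) =
      z • embNeg hA y.fst - extOp hA y.snd := fun y => by
    rw [← pencil_apply, hV, hP₂']
  rw [opSpectrum, Set.notMem_compl_iff]
  refine ⟨R, fun w => ?_, fun y => ?_⟩
  · obtain ⟨v, w₂, h, hh, hw, hTw⟩ := exists_of_mem_domain w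
    rw [hTw, hw]
    set y : Energy hA :=
      z • WithLp.toLp 2 (incl hA v, w₂) - WithLp.toLp 2 (-h, v) with hy
    have hy1 : y.fst = z • incl hA v + h := by simp [hy]
    have hy2 : y.snd = z • w₂ - v := by simp [hy]
    have h1 : V y = v := by
      rw [hV]
      refine Eq.trans (congrArg P ?_) (hP₁' v)
      rw [pencil_apply]
      rw [hy1, hy2, map_add, map_smul, hh, map_sub, map_smul, smul_add, smul_add, smul_smul, sq]
      abel
    have h2 : W y = w₂ := by
      apply (extIso hA).injective
      rw [extIso_apply, extIso_apply, hW, h1, hy1, map_add, map_smul, hh]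
      abel
    rw [hR, h1, h2]
  · have hh : embNeg hA (y.fst - z • incl hA (V y)) = D (V y) + extOp hA (W y) := by
      rw [hW, map_sub, map_smul]
      abel
    obtain ⟨w, hw, hTw⟩ := mem_genDomain hh
    refine ⟨w, by rw [hw, hR], ?_⟩
    have h1 : z • W y - V y = y.snd := by
      apply (extIso hA).injective
      have h2 := hLV y
      rw [extIso_apply, extIso_apply, map_sub, map_smul, hW, smul_sub, smul_sub, smul_smul, ← sq]
      rw [← sub_eq_zero] at h2 ⊢
      rw [← neg_eq_zero, ← h2]
      abel
    rw [hw, hTw]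
    apply WithLp.ofLp_injective
    ext
    · simp
    · simp [h1]

/-- A kernel vector v of L(z) extends to an element of the kernel of z - T with w₂ = -A⁻¹(zv + Dv).
Conversely L(z)v = f is solved by the first component for the right-hand side (0, -A⁻¹f). The open
mapping theorem then supplies a bounded inverse. -/
theorem notMem_pencilSpectrum_of_notMem_opSpectrum {z : ℂ}
    (hz : z ∉ opSpectrum (generator hA D)) : z ∉ pencilSpectrum hA D := by
  rw [opSpectrum, Set.notMem_compl_iff] at hz
  obtain ⟨R, hR₁, hR₂⟩ := hz
  have hinj : Function.Injective (pencil hA D z) := by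
    rw [injective_iff_map_eq_zero]
    intro v hv
    rw [pencil_apply] at hv
    obtain ⟨w₂, hw₂⟩ : ∃ w₂, extOp hA w₂ = -(z • embNeg hA (incl hA v)) - D v :=
      extOp_surjective hA _
    have h1 : z • w₂ = v := by
      apply (extIso hA).injective
      rw [extIso_apply, extIso_apply, map_smul, hw₂, ← sub_eq_zero, ← neg_eq_zero, ← hv, smul_sub,
        smul_neg, smul_smul, sq]
      abel
    obtain ⟨w, hw, hTw⟩ := mem_genDomain (D := D) (v := v) (w₂ := w₂) (h := -(z • incl hA v)) (by
      rw [hw₂, map_neg, map_smul]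
      abel)
    have h2 := hR₁ w
    have h3 : z • (w : Energy hA) - generator hA D w = 0 := by
      rw [hw, hTw]
      apply WithLp.ofLp_injective
      ext
      · simp
      · simp [h1]
    rw [h3, map_zero, hw] at h2
    have h4 : incl hA v = 0 := (congrArg WithLp.fst h2).symm
    exact (injective_iff_map_eq_zero _).mp (incl_injective hA) v h4
  have hsurj : Function.Surjective (pencil hA D z) := by
    intro f
    obtain ⟨y₂, hy₂⟩ := extOp_surjective hA (-f)
    obtain ⟨w, -, hw⟩ := hR₂ (WithLp.toLp 2 (0, y₂))
    obtain ⟨v, w₂, h, hh, hw', hTw⟩ := exists_of_mem_domain w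
    rw [hTw, hw'] at hw
    have h1 : z • incl hA v - -h = 0 := congrArg WithLp.fst hw
    have h2 : z • w₂ - v = y₂ := congrArg WithLp.snd hw
    refine ⟨v, ?_⟩
    have h3 := congrArg (embNeg hA) h1
    rw [sub_neg_eq_add, map_add, map_smul, map_zero, hh] at h3
    have h4 := congrArg (extOp hA) h2
    rw [map_sub, map_smul, hy₂] at h4
    have h5 := congrArg (fun f => z • f) h3
    simp only [smul_add, smul_smul, ← sq] at h5
    rw [pencil_apply, ← sub_eq_zero, sub_eq_add_neg, ← h4, ← smul_zero z, ← h5]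
    abel
  let e := ContinuousLinearEquiv.ofBijective (pencil hA D z) (LinearMap.ker_eq_bot.mpr hinj)
    (LinearMap.range_eq_top.mpr hsurj)
  rw [pencilSpectrum, Set.notMem_compl_iff]
  exact ⟨e.symm, ContinuousLinearMap.ext fun x => e.symm_apply_apply x,
    ContinuousLinearMap.ext fun f => e.apply_symm_apply f⟩

theorem pencilSpectrum_eq_opSpectrum :
    pencilSpectrum hA D = opSpectrum (generator hA D) := by
  ext z
  rw [← not_iff_not]
  exact ⟨notMem_opSpectrum_of_notMem_pencilSpectrum, notMem_pencilSpectrum_of_notMem_opSpectrum⟩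

/-- The numerical range of `T - 1` lies in a sector. -/
theorem abs_im_inner_generator_le {ν : ℝ} (hν : 0 < ν) (hD : IsAccretiveSectorial hA D ν)
    (hδ : 0 < dampDelta hA D) (w : (generator hA D).domain) :
    |(⟪(w : Energy hA), generator hA D w - ((1 : ℝ) : ℂ) • (w : Energy hA)⟫_ℂ).im| ≤
      (ν + 1 / dampDelta hA D + 1) *
        -(⟪(w : Energy hA), generator hA D w - ((1 : ℝ) : ℂ) • (w : Energy hA)⟫_ℂ).re := by
  obtain ⟨v, w₂, h, hh, hw, hTw⟩ := exists_of_mem_domain w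
  have h1 : ⟪incl hA v, h⟫_ℂ = D v v + ⟪v, w₂⟫_ℂ := by
    rw [← embNeg_apply, hh]
    rfl
  have h2 : ⟪(w : Energy hA), generator hA D w - ((1 : ℝ) : ℂ) • (w : Energy hA)⟫_ℂ =
      -D v v - ⟪v, w₂⟫_ℂ + ⟪w₂, v⟫_ℂ - ((‖incl hA v‖ ^ 2 + ‖w₂‖ ^ 2 : ℝ) : ℂ) := by
    rw [Complex.ofReal_one, one_smul, inner_sub_right, hw, hTw, WithLp.prod_inner_apply,
      WithLp.prod_inner_apply]
    simp only [inner_neg_right, h1, inner_self_eq_norm_sq_to_K]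
    push_cast
    simp only [Complex.coe_algebraMap]
    ring
  have hre : (⟪w₂, v⟫_ℂ).re = (⟪v, w₂⟫_ℂ).re := inner_re_symm (𝕜 := ℂ) _ _
  have him : (⟪w₂, v⟫_ℂ).im = -(⟪v, w₂⟫_ℂ).im := inner_im_symm (𝕜 := ℂ) _ _
  obtain ⟨p, hp⟩ : ∃ p, p = (D v v).re := ⟨_, rfl⟩
  obtain ⟨i, hi⟩ : ∃ i, i = (⟪v, w₂⟫_ℂ).im := ⟨_, rfl⟩
  have hp0 : 0 ≤ p := hp ▸ hD.accretive v
  have hs : |(D v v).im| ≤ ν * p := hp ▸ hD.sectorial v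
  have hi' : |i| ≤ ‖v‖ * ‖w₂‖ :=
    hi ▸ (Complex.abs_im_le_norm _).trans (norm_inner_le_norm (𝕜 := ℂ) v w₂)
  have hv : ‖v‖ ^ 2 ≤ 1 / dampDelta hA D * p := by
    rw [one_div_mul_eq_div, le_div_iff₀ hδ, mul_comm, hp]
    exact dampDelta_mul_le hD v
  rw [h2]
  simp only [Complex.add_re, Complex.sub_re, Complex.neg_re, Complex.add_im, Complex.sub_im,
    Complex.neg_im, Complex.ofReal_re, Complex.ofReal_im, hre, him, ← hp, ← hi]
  -- The coupling between v and w₂ is purely imaginary. It is at most ‖v‖² + ‖w₂‖²: the first term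
  -- is controlled by Re (Dv, v)/δ, the second by the shift by 1.
  have h3 : |-(D v v).im - i + -i - 0| ≤ ν * p + 2 * (‖v‖ * ‖w₂‖) := by
    rw [abs_le] at hs hi' ⊢
    constructor <;> linarith [hs.1, hs.2, hi'.1, hi'.2]
  have h4 : 2 * (‖v‖ * ‖w₂‖) ≤ ‖v‖ ^ 2 + ‖w₂‖ ^ 2 := by nlinarith [sq_nonneg (‖v‖ - ‖w₂‖)]
  have h5 : 0 ≤ (ν + 1 / dampDelta hA D) * (‖incl hA v‖ ^ 2 + ‖w₂‖ ^ 2) := by positivity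
  have h6 := sq_nonneg ‖incl hA v‖
  linarith

end Application

end DampedEquation

/-! ### The main theorem. -/

theorem theorem1 {H : Type*} [NormedAddCommGroup H] [InnerProductSpace ℂ H] [CompleteSpace H]
    (A : H →ₗ.[ℂ] H) (hA : DampedEquation.IsPosDefSelfAdjoint A)
    (D : DampedEquation.H₁ hA →L[ℂ] DampedEquation.Hneg hA)
    (ν : ℝ) (hν : 0 < ν) (hD : DampedEquation.IsAccretiveSectorial hA D ν)
    (α β δ ω : ℝ)
    (hα : α = DampedEquation.dampAlpha hA D)
    (hβ : β = DampedEquation.dampBeta hA D)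
    (hδ : δ = DampedEquation.dampDelta hA D)
    (hω : ω = DampedEquation.decayRate α β δ ‖D‖)
    (hpos : 0 < δ) :
    0 < ω ∧
    (∃ S : ℝ → DampedEquation.Energy hA →L[ℂ] DampedEquation.Energy hA,
      DampedEquation.IsC0Semigroup S ∧
      DampedEquation.IsGenerator (DampedEquation.generator hA D) S ∧
      DampedEquation.IsAnalyticSemigroup S ∧
      ∃ C : ℝ, ∀ t : ℝ, 0 ≤ t → ‖S t‖ ≤ C * Real.exp (-ω * t)) ∧
    DampedEquation.pencilSpectrum hA D =
      DampedEquation.opSpectrum (DampedEquation.generator hA D) ∧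
    ∀ b : ℝ, 0 ≤ b → ∃ M : ℝ,
      IsLeast ((fun θ => DampedEquation.slope ν β δ θ b) '' {θ : ℝ | 0 < θ ∧ b ^ 2 ≤ θ}) M ∧
      DampedEquation.pencilSpectrum hA D ⊆
        {z : ℂ | z.re ≤ -ω ∧ |z.im| ≤ M * |z.re| + b} := by
  have hα0 : 0 < α := hα ▸ DampedEquation.dampAlpha_pos hD (hδ ▸ hpos)
  have hβ0 : 0 < β := hβ ▸ DampedEquation.dampBeta_pos hD (hδ ▸ hpos)
  have hδN : δ ≤ ‖D‖ := hδ ▸ DampedEquation.dampDelta_le_norm hD (hδ ▸ hpos)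
  have hP : DampedEquation.PencilBounds (DampedEquation.massOp hA) (DampedEquation.dampOp hA D)
      α β δ ‖D‖ ν := by
    rw [hα, hβ, hδ]
    exact DampedEquation.pencilBounds hD
  have hω0 : 0 < ω := by
    obtain ⟨y, hy, -, h⟩ := DampedEquation.decayRate_eq (β := β) hα0 hpos (hpos.trans_le hδN)
    rw [hω, h]
    positivity
  have hre : ∀ z ∈ DampedEquation.pencilSpectrum hA D, z.re < -ω := fun z hz => by
    by_contra hc
    rw [not_lt, hω] at hc
    exact DampedEquation.notMem_pencilSpectrum_of_isUnit hA D
      (hP.isUnit_of_neg_decayRate_le hα0 hβ0 hpos hδN hc) hz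
  have heq := DampedEquation.pencilSpectrum_eq_opSpectrum (hA := hA) (D := D)
  refine ⟨hω0, ?_, heq, fun b hb => ?_⟩
  -- Nontriviality ensures that the spectrum at time 1 is nonempty, as the growth bound requires.
  · have : Nontrivial (DampedEquation.H₁ hA) :=
      DampedEquation.nontrivial_of_dampDelta_pos (hδ ▸ hpos)
    have : Nontrivial (DampedEquation.Energy hA) :=
      (WithLp.equiv 2 (H × DampedEquation.H₁ hA)).nontrivial
    refine DampedEquation.exists_analytic_semigroup (c := 1)
      (κ := ν + 1 / DampedEquation.dampDelta hA D + 1) ?_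
      (DampedEquation.abs_im_inner_generator_le hν hD (hδ ▸ hpos)) ?_ ?_
    · rw [← hδ]
      positivity
    · rw [← heq]
      intro h
      have := hre _ h
      rw [Complex.ofReal_re] at this
      linarith
    · rw [← heq]
      exact hre
  · obtain ⟨M, hM⟩ := DampedEquation.exists_isLeast_slope (ν := ν) hβ0 hpos hb
    refine ⟨M, hM, fun z hz => ⟨(hre z hz).le, ?_⟩⟩
    obtain ⟨⟨θ, ⟨hθ, hbθ⟩, hθM⟩, -⟩ := hM
    by_contra hc
    rw [not_le, ← hθM] at hc
    exact DampedEquation.notMem_pencilSpectrum_of_isUnit hA D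
      (hP.isUnit_of_slope_lt hβ0 hpos hν hb hθ hbθ (by linarith [hre z hz]) hc) hz
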